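/- Let $q$ be an odd prime power, let $(V,\omega)$ be a symplectic vector space of dimension $2n$ ($n\ge 0$) over $\mathbb{F}_q$, and let $\psi:\mathbb{F}_q\to\mathbb{C}^\times$ be a non-trivial additive character. Let $H=H(V)=V\times\mathbb{F}_q$ be the Heisenberg group, with multiplication $(v,z)(v',z')=(v+v',z+z'+\tfrac12\omega(v,v'))$ and center $Z=\{(0,z)\}\cong\mathbb{F}_q$; a subspace of $V$ is viewed inside $H$ via $v\mapsto(v,0)$. An oriented Lagrangian is a pair $L^\circ=(L,o_L)$ with $L\subset V$ Lagrangian and $0\ne o_L\in\bigwedge^n L$; $OLag(V)$ is the set of these. Let $\mathcal{H}_{L^\circ}$ be the space of functions $f:H\to\mathbb{C}$ with $f(z\cdot h)=\psi(z)f(h)$ and $f(l\cdot h)=f(h)$ for $z\in Z$, $l\in L$, on which $H$ acts by right translation. A trivialization is a system of $H$-equivariant isomorphisms $T_{M^\circ,L^\circ}:\mathcal{H}_{L^\circ}\to\mathcal{H}_{M^\circ}$, indexed by $(M^\circ,L^\circ)\in OLag(V)^2$, such that $T_{N^\circ,M^\circ}\circ T_{M^\circ,L^\circ}=T_{N^\circ,L^\circ}$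 for all $N^\circ,M^\circ,L^\circ$. There is a unique trivialization such that, whenever $L+M=V$, $$T_{M^\circ,L^\circ}[f](h)=\Big(\frac{G_1}{q}\Big)^{n}\,\sigma\Big((-1)^{\binom n2}\omega_\wedge(o_L,o_M)\Big)\sum_{m\in M}f(m\cdot h),\qquad G_1=\sum_{z\in\mathbb{F}_q}\psi(\tfrac12z^2),$$ where $\sigma$ is the quadratic character of $\mathbb{F}_q^\times$ and $\omega_\wedge:\bigwedge^nL\times\bigwedge^nM\to\mathbb{F}_q$ is the pairing $\omega_\wedge(l_1\wedge\dots\wedge l_n,\,m_1\wedge\dots\wedge m_n)=\det\big(\omega(l_i,m_{n+1-j})\big)_{i,j}=(-1)^{\binom n2}\det\big(\omega(l_i,m_j)\big)_{i,j}$. Its members are the canonical intertwining morphisms. Let $\mathbb{C}(M\backslash H/L,\psi)$ be the space of $k:H\to\mathbb{C}$ with $k(z\cdot h)=\psi(z)k(h)$ and $k(m\cdot h\cdot l)=k(h)$ for $z\in Z$, $m\in M$, $l\in L$. For $k\in\mathbb{C}(M\backslash H/L,\psi)$, and for $f\in\mathcal{H}_{L^\circ}$ or $f\in\mathbb{C}(L\backslash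 H/N,\psi)$ with $N$ a Lagrangian subspace, let $$(k*f)(h)=\sum_{[(a,b)]\in H\times_{Z\cdot L}H,\ ab=h}k(a)f(b),$$ where $H\times_{Z\cdot L}H$ is the quotient of $H\times H$ by the action $x\cdot(a,b)=(ax,x^{-1}b)$ of $Z\cdot L$. For every $(M^\circ,L^\circ)\in OLag(V)^2$ there is a unique $K_{M^\circ,L^\circ}\in\mathbb{C}(M\backslash H/L,\psi)$ such that $T_{M^\circ,L^\circ}f=K_{M^\circ,L^\circ}*f$ for all $f\in\mathcal{H}_{L^\circ}$, the canonical intertwining kernel. Put $K((M^\circ,L^\circ),h)=K_{M^\circ,L^\circ}(h)$, a function on $OLag(V)^2\times H$, and let $p_{ij}((L_1^\circ,L_2^\circ,L_3^\circ),h)=((L_i^\circ,L_j^\circ),h)$. Then, on $OLag(V)^3\times H$, $$p_{12}^*K*p_{23}^*K=p_{13}^*K,$$ where the left-hand side is the fiberwise convolution $K((L_1^\circ,L_2^\circ),-)*K((L_2^\circ,L_3^\circ),-)$, taken over $Z\cdot L_2$. -/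

import Mathlib

noncomputable section

namespace StrongSvN

/-- The Heisenberg group `H(V) = V × F` of a space `V` with a bilinear form `ω`. -/
@[ext]
structure Heisenberg {F V : Type*} [Field F] [AddCommGroup V] [Module F V]
    (ω : V →ₗ[F] V →ₗ[F] F) where
  vec : V
  cen : F

section

variable {F V : Type*} [Field F] [AddCommGroup V] [Module F V]

namespace Heisenberg

variable {ω : V →ₗ[F] V →ₗ[F] F}

instance : Mul (Heisenberg ω) :=
  ⟨fun a b => ⟨a.vec + b.vec, a.cen + b.cen + 2⁻¹ * ω a.vec b.vec⟩⟩

instance : One (Heisenberg ω) := ⟨⟨0, 0⟩⟩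

instance : Inv (Heisenberg ω) := ⟨fun a => ⟨-a.vec, -a.cen + 2⁻¹ * ω a.vec a.vec⟩⟩

@[simp] theorem vec_mul (a b : Heisenberg ω) : (a * b).vec = a.vec + b.vec := rfl

@[simp] theorem cen_mul (a b : Heisenberg ω) :
    (a * b).cen = a.cen + b.cen + 2⁻¹ * ω a.vec b.vec := rfl

@[simp] theorem vec_one : (1 : Heisenberg ω).vec = 0 := rfl

@[simp] theorem cen_one : (1 : Heisenberg ω).cen = 0 := rfl

@[simp] theorem vec_inv (a : Heisenberg ω) : (a⁻¹).vec = -a.vec := rfl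

@[simp] theorem cen_inv (a : Heisenberg ω) : (a⁻¹).cen = -a.cen + 2⁻¹ * ω a.vec a.vec := rfl

/-- The group law `(v, z) * (v', z') = (v + v', z + z' + ½ ω(v, v'))`.  The inverse is written so
that the group axioms hold for every bilinear `ω`; it is `(-v, -z)` when `ω` is alternating. -/
instance : Group (Heisenberg ω) where
  mul_assoc a b c := by
    ext
    · simp [add_assoc]
    · simp only [cen_mul, vec_mul, map_add, LinearMap.add_apply]
      ring
  one_mul a := by ext <;> simp
  mul_one a := by ext <;> simp
  inv_mul_cancel a := by ext <;> simp

variable (ω) in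
/-- The element `(v, 0)` of the Heisenberg group. -/
def ofVec (v : V) : Heisenberg ω := ⟨v, 0⟩

variable (ω) in
/-- The central element `(0, z)` of the Heisenberg group. -/
def ofCen (z : F) : Heisenberg ω := ⟨0, z⟩

end Heisenberg

open Heisenberg

/-- An oriented Lagrangian subspace of a symplectic space `(V, ω)` of dimension `2 * n`: a subspace
`L` which equals its own `ω`-orthogonal complement (so that `dim L = n`), together with a nonzero
vector of its top exterior power `⋀ⁿ L`. -/
structure OLag (ω : V →ₗ[F] V →ₗ[F] F) (n : ℕ) where
  sub : Submodule F V
  lagrangian : sub.orthogonalBilin ω = sub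
  orient : ⋀[F]^n sub
  orient_ne_zero : orient ≠ 0

variable {ω : V →ₗ[F] V →ₗ[F] F} {n : ℕ}

/-- Two oriented Lagrangians are in general position if their sum is the whole space. -/
def OLag.GenPos (M L : OLag ω n) : Prop := M.sub ⊔ L.sub = ⊤

/-- The subgroup `Z · L = {(l, z) : l ∈ L}` of the Heisenberg group. -/
def OLag.zSubgroup (L : OLag ω n) : Subgroup (Heisenberg ω) where
  carrier := {h | h.vec ∈ L.sub}
  mul_mem' ha hb := L.sub.add_mem ha hb
  one_mem' := L.sub.zero_mem
  inv_mem' ha := L.sub.neg_mem ha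

/-- The model `ℋ_L`: functions `f` on `H(V)` with `f (z * h) = ψ z * f h` for central `z` and
`f (l * h) = f h` for `l ∈ L`. -/
def model (ψ : AddChar F ℂ) (L : OLag ω n) : Submodule ℂ (Heisenberg ω → ℂ) where
  carrier := {f | (∀ z h, f (ofCen ω z * h) = ψ z * f h) ∧
    ∀ l ∈ L.sub, ∀ h, f (ofVec ω l * h) = f h}
  add_mem' {f g} hf hg := by
    refine ⟨fun z h => ?_, fun l hl h => ?_⟩
    · simp only [Pi.add_apply, hf.1, hg.1, mul_add]
    · simp only [Pi.add_apply, hf.2 l hl, hg.2 l hl]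
  zero_mem' := by simp
  smul_mem' c f hf := by
    refine ⟨fun z h => ?_, fun l hl h => ?_⟩
    · simp only [Pi.smul_apply, smul_eq_mul, hf.1]
      ring
    · simp only [Pi.smul_apply, hf.2 l hl]

/-- The Heisenberg representation on the model `ℋ_L`, by right translation:
`(π_L(h) f)(h') = f (h' * h)`. -/
def heisRep (ψ : AddChar F ℂ) (L : OLag ω n) : Representation ℂ (Heisenberg ω) (model ψ L) where
  toFun h :=
    { toFun := fun f => ⟨fun h' => f.1 (h' * h), by
        refine ⟨fun z h' => ?_, fun l hl h' => ?_⟩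
        · beta_reduce
          rw [mul_assoc, f.2.1]
        · beta_reduce
          rw [mul_assoc, f.2.2 l hl]⟩
      map_add' := fun _ _ => rfl
      map_smul' := fun _ _ => rfl }
  map_one' := by
    ext f h
    simp
  map_mul' a b := by
    ext f h
    simp [mul_assoc]

/-- Functions `k` on `H(V)` with `k (z * h) = ψ z * k h` for central `z` and
`k (m * h * l) = k h` for `m ∈ M`, `l ∈ L`. -/
def kernelSpace (ψ : AddChar F ℂ) (M L : OLag ω n) : Submodule ℂ (Heisenberg ω → ℂ) where
  carrier := {k | (∀ z h, k (ofCen ω z * h) = ψ z * k h) ∧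
    ∀ m ∈ M.sub, ∀ l ∈ L.sub, ∀ h, k (ofVec ω m * h * ofVec ω l) = k h}
  add_mem' {f g} hf hg := by
    refine ⟨fun z h => ?_, fun m hm l hl h => ?_⟩
    · simp only [Pi.add_apply, hf.1, hg.1, mul_add]
    · simp only [Pi.add_apply, hf.2 m hm l hl, hg.2 m hm l hl]
  zero_mem' := by simp
  smul_mem' c f hf := by
    refine ⟨fun z h => ?_, fun m hm l hl h => ?_⟩
    · simp only [Pi.smul_apply, smul_eq_mul, hf.1]
      ring
    · simp only [Pi.smul_apply, hf.2 m hm l hl]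

/-! ### The normalized intertwiners in general position -/

/-- The pairing `ω_∧ : ⋀ⁿ L × ⋀ⁿ M → F` induced by `ω` by contracting adjacent vectors of
`l₁ ∧ ⋯ ∧ lₙ`, `m₁ ∧ ⋯ ∧ mₙ` from the inside outwards: its value there is
`det (ω lᵢ mₙ₊₁₋ⱼ) = (-1) ^ (n choose 2) * det (ω lᵢ mⱼ)`. -/
def wedgePairing (L M : OLag ω n) (a : ⋀[F]^n L.sub) (b : ⋀[F]^n M.sub) : F :=
  (-1) ^ (n.choose 2) *
    exteriorPower.pairingDual F M.sub n
      (exteriorPower.map n (ω.domRestrict₁₂ L.sub M.sub) a) b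

theorem wedgePairing_ιMulti (L M : OLag ω n) (l : Fin n → L.sub) (m : Fin n → M.sub) :
    wedgePairing L M (exteriorPower.ιMulti F n l) (exteriorPower.ιMulti F n m) =
      (-1) ^ (n.choose 2) * Matrix.det (Matrix.of fun i j => ω (l i) (m j)) := by
  rw [wedgePairing, exteriorPower.map_apply_ιMulti, exteriorPower.pairingDual_ιMulti_ιMulti,
    ← Matrix.det_transpose]
  rfl

/-- The Gauss sum `G₁ = ∑ z, ψ (½ z²)`. -/
def gaussSumOne [Fintype F] (ψ : AddChar F ℂ) : ℂ := ∑ z : F, ψ (2⁻¹ * z ^ 2)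

open scoped Classical in
/-- The normalization constant
`A_{M, L} = (G₁ / q) ^ n * σ ((-1) ^ (n choose 2) * ω_∧(o_L, o_M))`. -/
def normConst [Fintype F] (ψ : AddChar F ℂ) (M L : OLag ω n) : ℂ :=
  (gaussSumOne ψ / (Fintype.card F : ℂ)) ^ n *
    ((quadraticChar F ((-1) ^ (n.choose 2) * wedgePairing L M L.orient M.orient) : ℤ) : ℂ)

/-- The average `F_{M, L} f (h) = ∑ m ∈ M, f (m * h)`. -/
def average (M : OLag ω n) (f : Heisenberg ω → ℂ) (h : Heisenberg ω) : ℂ :=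
  ∑ᶠ m : M.sub, f (ofVec ω m.1 * h)

/-! ### The canonical intertwining morphisms -/

/-- A system of intertwining morphisms `T_{M, L} : ℋ_L → ℋ_M`, one for each pair `(M, L)` of
oriented Lagrangians. -/
abbrev IntertwinerSystem (ω : V →ₗ[F] V →ₗ[F] F) (n : ℕ) (ψ : AddChar F ℂ) :=
  (M L : OLag ω n) → Representation.IntertwiningMap (heisRep ψ L) (heisRep ψ M)

/-- A trivialization: a system of intertwining isomorphisms with `T_{N,M} ∘ T_{M,L} = T_{N,L}`. -/
def IsTrivialization {ψ : AddChar F ℂ} (T : IntertwinerSystem ω n ψ) : Prop :=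
  (∀ M L, Function.Bijective (T M L)) ∧
    ∀ N M L, ∀ f : model ψ L, T N M (T M L f) = T N L f

/-- A trivialization given by the normalized averages `A_{M, L} • F_{M, L}` on all pairs in general
position. -/
def IsCanonicalSystem [Fintype F] {ψ : AddChar F ℂ} (T : IntertwinerSystem ω n ψ) : Prop :=
  IsTrivialization T ∧
    ∀ M L : OLag ω n, M.GenPos L → ∀ (f : model ψ L) (h : Heisenberg ω),
      (T M L f).1 h = normConst ψ M L * average M f.1 h

end

/-! ### Convolution and kernels -/

section

variable {G : Type*} [Group G]

/-- Two pairs in `G × G` are related if they lie in one orbit of the action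
`x · (a, b) = (a x, x⁻¹ b)` of the subgroup `P`. -/
def balancedSetoid (P : Subgroup G) : Setoid (G × G) where
  r a b := ∃ x ∈ P, b = (a.1 * x, x⁻¹ * a.2)
  iseqv :=
    { refl := fun a => ⟨1, P.one_mem, by simp⟩
      symm := by
        rintro a b ⟨x, hx, rfl⟩
        exact ⟨x⁻¹, P.inv_mem hx, by simp⟩
      trans := by
        rintro a b c ⟨x, hx, rfl⟩ ⟨y, hy, rfl⟩
        exact ⟨x * y, P.mul_mem hx hy, by simp [mul_assoc]⟩ }

/-- The balanced product `G ×_P G`. -/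
def BalancedProduct (P : Subgroup G) : Type _ := Quotient (balancedSetoid P)

/-- The multiplication map `G ×_P G → G`. -/
def BalancedProduct.mulMap {P : Subgroup G} : BalancedProduct P → G :=
  Quotient.lift (fun a : G × G => a.1 * a.2) (by
    rintro a b ⟨x, -, rfl⟩
    simp [mul_assoc])

/-- The descent of `(a, b) ↦ k a * f b` to `G ×_P G`, evaluated on a representative. -/
def descent (P : Subgroup G) (k f : G → ℂ) (y : BalancedProduct P) : ℂ :=
  k (Quotient.out y).1 * f (Quotient.out y).2

/-- If `(a, b) ↦ k a * f b` is invariant under `P`, its descent does not depend on the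
representative. -/
theorem descent_mk (P : Subgroup G) (k f : G → ℂ)
    (hkf : ∀ a b, ∀ x ∈ P, k (a * x) * f (x⁻¹ * b) = k a * f b) (a b : G) :
    descent P k f (Quotient.mk (balancedSetoid P) (a, b)) = k a * f b := by
  obtain ⟨x, hx, h⟩ := Quotient.exact (Quotient.out_eq (Quotient.mk (balancedSetoid P) (a, b)))
  calc descent P k f (Quotient.mk (balancedSetoid P) (a, b))
      = k (Quotient.out (Quotient.mk (balancedSetoid P) (a, b))).1 *
          f (Quotient.out (Quotient.mk (balancedSetoid P) (a, b))).2 := rfl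
    _ = k (a, b).1 * f (a, b).2 := by
        conv_rhs => rw [h]
        exact (hkf _ _ x hx).symm

/-- The convolution `k ∗ f = m_! (k ⊠_P f)`: the descent of `k ⊠ f` to `G ×_P G`, summed along the
fibres of the multiplication map. -/
def conv (P : Subgroup G) (k f : G → ℂ) (h : G) : ℂ :=
  ∑ᶠ y : {y : BalancedProduct P // y.mulMap = h}, descent P k f y.1

end

section

variable {F V : Type*} [Field F] [AddCommGroup V] [Module F V]
  {ω : V →ₗ[F] V →ₗ[F] F} {n : ℕ}

/-- `K` is the function on `OLag(V)² × H(V)` of a system of kernels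
`K_{M, L} ∈ ℂ(M \ H(V) / L, ψ)` with `I[K_{M, L}] = T_{M, L}`, where `I[k] f = k ∗ f`. -/
def IsKernelFunction {ψ : AddChar F ℂ} (T : IntertwinerSystem ω n ψ)
    (K : (OLag ω n × OLag ω n) × Heisenberg ω → ℂ) : Prop :=
  ∀ M L : OLag ω n, (fun h => K ((M, L), h)) ∈ kernelSpace ψ M L ∧
    ∀ f : model ψ L, (T M L f).1 = conv L.zSubgroup (fun h => K ((M, L), h)) f.1

/-- The projection `((L₁, L₂, L₃), h) ↦ ((L₁, L₂), h)`. -/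
def p₁₂ (x : (OLag ω n × OLag ω n × OLag ω n) × Heisenberg ω) :
    (OLag ω n × OLag ω n) × Heisenberg ω := ((x.1.1, x.1.2.1), x.2)

/-- The projection `((L₁, L₂, L₃), h) ↦ ((L₂, L₃), h)`. -/
def p₂₃ (x : (OLag ω n × OLag ω n × OLag ω n) × Heisenberg ω) :
    (OLag ω n × OLag ω n) × Heisenberg ω := ((x.1.2.1, x.1.2.2), x.2)

/-- The projection `((L₁, L₂, L₃), h) ↦ ((L₁, L₃), h)`. -/
def p₁₃ (x : (OLag ω n × OLag ω n × OLag ω n) × Heisenberg ω) :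
    (OLag ω n × OLag ω n) × Heisenberg ω := ((x.1.1, x.1.2.2), x.2)

/-- Fibrewise convolution of functions on `OLag(V)³ × H(V)`: over `(L₁, L₂, L₃)` it is the
convolution over `Z · L₂`. -/
def fiberConv (A B : (OLag ω n × OLag ω n × OLag ω n) × Heisenberg ω → ℂ) :
    (OLag ω n × OLag ω n × OLag ω n) × Heisenberg ω → ℂ :=
  fun x => conv x.1.2.1.zSubgroup (fun h => A (x.1, h)) (fun h => B (x.1, h)) x.2

end

end StrongSvN

end

/-! An intertwiner `ℋ_L → ℋ_M` is determined by one number, the value at `1` of its image of the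
delta function `δ_L`: this image lies in `kernelSpace ψ M L`, where evaluation at `1` is injective
(`kernelSpace_eq_zero`), and the translates of `δ_L` span `ℋ_L` (`card_smul_model`). Identities
between intertwiners thus become identities between constants.

Write `A_{M,P}` for the normalized average. If `P` is transversal to `M` and `L`, and `φ : M → L` is
the projection along `P`, the constant of `A_{M,P} ∘ A_{P,L}` is a sign times a power of `G₁ / q`
times the Gauss sum of the symmetric form `ω(φ x, y)` on `M`. Another choice of `P` replaces `φ` by
`φ ∘ u`, with `u` the identity on the radical. The sign and the Gauss sum both change by `σ(det u)`,
so the composite does not depend on `P` (`compositeConst_eq`); this is what the orientations are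
for. It is `A_{M,L}` when `M` and `L` are transversal, and the identity when `M = L`, by `G₁² =
σ(-1) q`.

Any three Lagrangians have a common complement `Q` (`exists_genPos_three`), so the cocycle identity
reads `A_{N,Q} A_{Q,M} A_{M,Q} A_{Q,L} = A_{N,Q} A_{Q,L}`. Uniqueness holds because every `T_{M,L}`
factors through transversal pairs.

For kernels, `δ_L` is a right unit for convolution, so `K_{M,L} = T_{M,L} δ_L`. Convolving
`K_{L₁,L₂}` with `K_{L₂,L₃}` then applies `T_{L₁,L₂}` to `T_{L₂,L₃} δ_{L₃}`, and the cocycle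
identity finishes. -/

noncomputable section

namespace StrongSvN

/-! ### Gauss sums of quadratic forms over a finite field -/

section GaussSums

theorem addChar_sum {F ι : Type*} [Field F] (ψ : AddChar F ℂ) (s : Finset ι) (f : ι → F) :
    ψ (∑ i ∈ s, f i) = ∏ i ∈ s, ψ (f i) := by
  classical
  induction s using Finset.induction_on with
  | empty => simp
  | insert a s ha ih => rw [Finset.sum_insert ha, Finset.prod_insert ha, AddChar.map_add_eq_mul, ih]

variable {F : Type*} [Field F] [Fintype F]

open scoped Classical in
/-- The quadratic character of `F`, with complex values. -/
def complexQuadraticChar (a : F) : ℂ := ((quadraticChar F a : ℤ) : ℂ)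

theorem complexQuadraticChar_mul (a b : F) :
    complexQuadraticChar (a * b) = complexQuadraticChar a * complexQuadraticChar b := by
  simp only [complexQuadraticChar, map_mul, Int.cast_mul]

theorem complexQuadraticChar_mul_self {a : F} (ha : a ≠ 0) :
    complexQuadraticChar a * complexQuadraticChar a = 1 := by
  classical
  have h := quadraticChar_sq_one ha
  rw [pow_two] at h
  rw [complexQuadraticChar]
  exact_mod_cast h

theorem complexQuadraticChar_mul_mul_self {a : F} (ha : a ≠ 0) (b : F) :
    complexQuadraticChar (b * (a * a)) = complexQuadraticChar b := by
  rw [complexQuadraticChar_mul, complexQuadraticChar_mul, complexQuadraticChar_mul_self ha, mul_one]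

theorem complexQuadraticChar_prod {ι : Type*} (s : Finset ι) (d : ι → F) :
    complexQuadraticChar (∏ i ∈ s, d i) = ∏ i ∈ s, complexQuadraticChar (d i) := by
  simp [complexQuadraticChar]

theorem complexQuadraticChar_pow (a : F) (n : ℕ) :
    complexQuadraticChar (a ^ n) = complexQuadraticChar a ^ n := by
  simp only [complexQuadraticChar, map_pow, Int.cast_pow]

theorem ringChar_ne_two (hq : Odd (Fintype.card F)) : ringChar F ≠ 2 := fun h => by
  have := FiniteField.even_card_iff_char_two.mp h
  rw [Nat.odd_iff] at hq
  omega

theorem two_ne_zero_of_odd (hq : Odd (Fintype.card F)) : (2 : F) ≠ 0 :=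
  Ring.two_ne_zero (ringChar_ne_two hq)

variable {ψ : AddChar F ℂ}

-- Each `y` has `σ(y) + 1` square roots, and the sum of `ψ (c * y)` vanishes, which leaves a shifted
-- linear Gauss sum.
open scoped Classical in
theorem sum_addChar_mul_sq (hq : Odd (Fintype.card F)) (hψ : ψ ≠ 1) {c : F} (hc : c ≠ 0) :
    ∑ z : F, ψ (c * z ^ 2) =
      complexQuadraticChar c * gaussSum ((quadraticChar F).ringHomComp (Int.castRingHom ℂ)) ψ := by
  have hF := ringChar_ne_two hq
  have h1 : ∑ z : F, ψ (c * z ^ 2) = ∑ y : F, ((quadraticChar F y : ℤ) + 1 : ℂ) * ψ (c * y) := by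
    rw [← Finset.sum_fiberwise (s := Finset.univ) (g := fun z : F => z ^ 2)]
    refine Finset.sum_congr rfl fun y _ => ?_
    rw [Finset.sum_congr rfl (g := fun _ => ψ (c * y)), Finset.sum_const, nsmul_eq_mul]
    · congr 1
      have := quadraticChar_card_sqrts hF y
      rw [Set.toFinset_ofPred] at this
      exact_mod_cast this
    · intro z hz
      rw [(Finset.mem_filter.mp hz).2]
  have h2 : ∑ y : F, ψ (c * y) = 0 := by
    have := AddChar.sum_eq_zero_of_ne_one (AddChar.IsPrimitive.of_ne_one hψ hc)
    simpa using this
  have h3 := gaussSum_mulShift ((quadraticChar F).ringHomComp (Int.castRingHom ℂ)) ψ (Units.mk0 c hc)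
  rw [h1, ← h3]
  simp only [add_mul, one_mul, Finset.sum_add_distrib, h2, add_zero]
  simp only [Units.val_mk0, MulChar.ringHomComp_apply, eq_intCast, gaussSum,
    AddChar.mulShift_apply]
  rw [← mul_assoc]
  change _ = complexQuadraticChar c * complexQuadraticChar c * _
  rw [complexQuadraticChar_mul_self hc, one_mul]

theorem sum_addChar_half_mul_sq (hq : Odd (Fintype.card F)) (hψ : ψ ≠ 1) {a : F} (ha : a ≠ 0) :
    ∑ z : F, ψ (2⁻¹ * (a * z ^ 2)) = complexQuadraticChar a * gaussSumOne ψ := by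
  have h2 := inv_ne_zero (two_ne_zero_of_odd hq)
  rw [gaussSumOne, sum_addChar_mul_sq hq hψ h2]
  simp_rw [← mul_assoc]
  rw [sum_addChar_mul_sq hq hψ (mul_ne_zero h2 ha), complexQuadraticChar_mul]
  ring

theorem gaussSumOne_sq (hq : Odd (Fintype.card F)) (hψ : ψ ≠ 1) :
    gaussSumOne ψ ^ 2 = complexQuadraticChar (-1 : F) * Fintype.card F := by
  classical
  have h2 := inv_ne_zero (two_ne_zero_of_odd hq)
  have hF := ringChar_ne_two hq
  rw [gaussSumOne, sum_addChar_mul_sq hq hψ h2, mul_pow, pow_two,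
    complexQuadraticChar_mul_self h2, one_mul, gaussSum_sq _ _ (AddChar.IsPrimitive.of_ne_one hψ)]
  · simp [complexQuadraticChar]
  · obtain ⟨a, ha⟩ := quadraticChar_exists_neg_one' hF
    intro h
    have := congrArg (fun χ : MulChar F ℂ => χ a) h
    simp only [MulChar.ringHomComp_apply, ha, MulChar.one_apply_coe] at this
    norm_num at this
  · exact (quadraticChar_isQuadratic F).comp _

variable {M : Type*} [AddCommGroup M] [Module F M] [Fintype M]

open Module

/-- The Gauss sum of a nondegenerate quadratic form is determined by its discriminant. -/
theorem sum_addChar_bilinForm (hq : Odd (Fintype.card F)) (hψ : ψ ≠ 1)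
    {B : LinearMap.BilinForm F M} (hB : B.IsSymm) {d : ℕ} (b : Basis (Fin d) F M)
    (hdet : (LinearMap.BilinForm.toMatrix b B).det ≠ 0) :
    ∑ x : M, ψ (2⁻¹ * B x x) =
      complexQuadraticChar (LinearMap.BilinForm.toMatrix b B).det * gaussSumOne ψ ^ d := by
  obtain rfl : finrank F M = d := by simpa using finrank_eq_card_basis b
  have : Invertible (2 : F) := invertibleOfNonzero (two_ne_zero_of_odd hq)
  obtain ⟨v, hv⟩ := LinearMap.BilinForm.exists_orthogonal_basis
    (LinearMap.BilinForm.isSymm_iff.mp hB)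
  have hoff : ∀ i j, i ≠ j → B (v i) (v j) = 0 := fun i j hij => hv hij
  have hdiag : LinearMap.BilinForm.toMatrix v B = Matrix.diagonal fun i => B (v i) (v i) := by
    ext i j
    rw [LinearMap.BilinForm.toMatrix_apply]
    by_cases hij : i = j
    · subst hij
      simp
    · rw [Matrix.diagonal_apply_ne _ hij, hoff i j hij]
  -- Change of basis multiplies the discriminant by a square, which the quadratic character ignores;
  -- an orthogonal basis therefore suffices.
  have hvb := congrArg Matrix.det (LinearMap.BilinForm.toMatrix_mul_basis_toMatrix b v B)
  rw [hdiag, Matrix.det_mul, Matrix.det_mul, Matrix.det_transpose, Matrix.det_diagonal,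
    mul_comm _ (LinearMap.BilinForm.toMatrix b B).det, mul_assoc] at hvb
  have hunit : (b.toMatrix v).det ≠ 0 := (b.isUnit_det v).ne_zero
  have hd : ∀ i, B (v i) (v i) ≠ 0 := by
    have : ∏ i, B (v i) (v i) ≠ 0 := by
      rw [← hvb]
      exact mul_ne_zero hdet (mul_ne_zero hunit hunit)
    exact fun i => Finset.prod_ne_zero_iff.mp this i (Finset.mem_univ i)
  have hself : ∀ c : Fin (finrank F M) → F, B (v.equivFun.symm c) (v.equivFun.symm c) =
      ∑ i, B (v i) (v i) * c i ^ 2 := by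
    intro c
    rw [Basis.equivFun_symm_apply]
    simp only [map_sum, LinearMap.sum_apply, map_smul, LinearMap.smul_apply, smul_eq_mul]
    refine Finset.sum_congr rfl fun i _ => ?_
    rw [Finset.sum_eq_single i]
    · ring
    · intro j _ hj
      rw [hoff j i hj]
      ring
    · simp
  calc ∑ x : M, ψ (2⁻¹ * B x x)
      = ∑ c : Fin (finrank F M) → F, ∏ i, ψ (2⁻¹ * (B (v i) (v i) * c i ^ 2)) := by
        refine (Fintype.sum_equiv v.equivFun.symm.toEquiv _ _ fun c => ?_).symm
        rw [LinearEquiv.coe_toEquiv, hself, Finset.mul_sum, addChar_sum]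
    _ = ∏ i, ∑ z : F, ψ (2⁻¹ * (B (v i) (v i) * z ^ 2)) := by
        rw [Finset.prod_univ_sum, Fintype.piFinset_univ]
    _ = ∏ i, complexQuadraticChar (B (v i) (v i)) * gaussSumOne ψ :=
        Finset.prod_congr rfl fun i _ => sum_addChar_half_mul_sq hq hψ (hd i)
    _ = _ := by
        rw [Finset.prod_mul_distrib, ← complexQuadraticChar_prod, ← hvb,
          complexQuadraticChar_mul_mul_self hunit]
        simp

/-- If `u` is the identity on the radical of `B`, twisting `B` by `u` multiplies its Gauss sum by
the quadratic character of `det u`. -/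
theorem sum_addChar_bilinForm_compLeft (hq : Odd (Fintype.card F)) (hψ : ψ ≠ 1)
    {B : LinearMap.BilinForm F M} (hB : B.IsSymm) (u : M →ₗ[F] M)
    (hBu : ∀ x y, B (u x) y = B (u y) x) (hu : ∀ x, B x = 0 → u x = x)
    (hdet : LinearMap.det u ≠ 0) :
    ∑ x : M, ψ (2⁻¹ * B (u x) x) =
      complexQuadraticChar (LinearMap.det u) * ∑ x : M, ψ (2⁻¹ * B x x) := by
  classical
  let I : Submodule F M := LinearMap.ker B
  have : Fintype (M ⧸ I) := Fintype.ofFinite _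
  have : Fintype I := Fintype.ofFinite _
  have hsymm : ∀ x y, B x y = B y x := fun x y => hB.eq x y
  -- A linear section `s` of the quotient by the radical `I` transports `B` to a nondegenerate form
  -- `C` there.
  obtain ⟨s, hs⟩ := I.mkQ.exists_rightInverse_of_surjective I.range_mkQ
  have hs' : ∀ y, I.mkQ (s y) = y := fun y => LinearMap.congr_fun hs y
  have hker : ∀ x, B x = B (s (I.mkQ x)) := by
    intro x
    have : x - s (I.mkQ x) ∈ I := by
      rw [← Submodule.Quotient.mk_eq_zero, ← Submodule.mkQ_apply, map_sub, hs', sub_self]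
    exact sub_eq_zero.mp ((map_sub B _ _).symm.trans (LinearMap.mem_ker.mp this))
  let C : LinearMap.BilinForm F (M ⧸ I) := B.comp s s
  have hC : ∀ x y, B x y = C (I.mkQ x) (I.mkQ y) := by
    intro x y
    rw [LinearMap.BilinForm.comp_apply, hker x, hsymm, hker y, hsymm]
  have huI : I ≤ I.comap u := fun x hx => by
    rw [Submodule.mem_comap, hu x hx]
    exact hx
  let w := I.mapQ I u huI
  -- No determinant is lost in the quotient, since `u` is the identity on the radical.
  have hdetw : LinearMap.det u = LinearMap.det w := by
    rw [LinearMap.det_eq_det_mul_det I u huI]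
    have : u.restrict huI = LinearMap.id := by
      ext x
      exact hu x x.2
    rw [this, LinearMap.det_id, one_mul]
  -- Every fibre of `M → M ⧸ I` has `|I|` elements, so both sums acquire the same factor.
  let e : M ≃ I × (M ⧸ I) :=
    { toFun := fun x => (⟨x - s (I.mkQ x), by
        rw [← Submodule.Quotient.mk_eq_zero, ← Submodule.mkQ_apply, map_sub, hs', sub_self]⟩,
        I.mkQ x)
      invFun := fun p => p.1 + s p.2
      left_inv := fun x => by simp
      right_inv := fun p => by
        have h0 : I.mkQ (p.1 : M) = 0 := by simp
        ext1
        · ext1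
          simp only [map_add, h0, hs', zero_add, add_sub_cancel_right]
        · simp only [map_add, h0, hs', zero_add] }
  have hsum : ∀ f : M ⧸ I → ℂ, ∑ x, f (I.mkQ x) = (Fintype.card I : ℂ) * ∑ y, f y := by
    intro f
    rw [Fintype.sum_equiv e (fun x => f (I.mkQ x)) (fun p => f p.2) (fun _ => rfl),
      Fintype.sum_prod_type]
    simp
  let b := finBasis F (M ⧸ I)
  have hCnd : C.Nondegenerate := by
    have hl : ∀ y, (∀ z, C y z = 0) → y = 0 := by
      intro y hy
      rw [← hs' y, Submodule.mkQ_apply, Submodule.Quotient.mk_eq_zero]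
      refine LinearMap.mem_ker.mpr (LinearMap.ext fun x => ?_)
      rw [hC, hs', hy]
      rfl
    refine ⟨hl, fun y hy => hl y fun z => ?_⟩
    have := hy z
    rw [LinearMap.BilinForm.comp_apply, hsymm] at this
    exact this
  have hCdet : (LinearMap.BilinForm.toMatrix b C).det ≠ 0 :=
    (LinearMap.BilinForm.nondegenerate_iff_det_ne_zero b).mp hCnd
  have hCw : (LinearMap.BilinForm.toMatrix b (C.compLeft w)).det =
      LinearMap.det u * (LinearMap.BilinForm.toMatrix b C).det := by
    rw [LinearMap.BilinForm.toMatrix_compLeft, Matrix.det_mul, Matrix.det_transpose,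
      LinearMap.det_toMatrix, hdetw]
  have hqw : ∀ x, I.mkQ (u x) = w (I.mkQ x) := fun _ => rfl
  have hCsymm : C.IsSymm := ⟨fun x y => hsymm _ _⟩
  have hCwsymm : (C.compLeft w).IsSymm := by
    refine ⟨fun x y => ?_⟩
    have := hBu (s x) (s y)
    rw [hC, hC, hqw, hqw, hs', hs'] at this
    exact this
  have h1 := sum_addChar_bilinForm hq hψ hCsymm b hCdet
  have h2 := sum_addChar_bilinForm hq hψ hCwsymm b (by
    rw [hCw]
    exact mul_ne_zero hdet hCdet)
  rw [hCw, complexQuadraticChar_mul, mul_assoc, ← h1] at h2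
  have h3 := hsum fun y => ψ (2⁻¹ * C y y)
  have h4 := hsum fun y => ψ (2⁻¹ * (C.compLeft w) y y)
  simp only [← hC] at h3
  rw [h2] at h4
  simp only [LinearMap.BilinForm.compLeft_apply, ← hqw, ← hC] at h4
  rw [h4, h3]
  ring

end GaussSums

open Module

/-! ### Lagrangian subspaces, common complements and orientations -/

section Transversals

variable {F V : Type*} [Field F] [AddCommGroup V] [Module F V]

theorem exists_notMem_sup_two {U A B : Submodule F V} (hA : ¬U ≤ A) (hB : ¬U ≤ B) :
    ∃ v ∈ U, v ∉ A ∧ v ∉ B := by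
  obtain ⟨a, haU, ha⟩ := SetLike.not_le_iff_exists.mp hA
  obtain ⟨b, hbU, hb⟩ := SetLike.not_le_iff_exists.mp hB
  by_cases hab : a ∈ B
  · by_cases hba : b ∈ A
    · refine ⟨a + b, U.add_mem haU hbU, fun h => ha ?_, fun h => hb ?_⟩
      · exact (A.add_mem_iff_left hba).mp h
      · exact (B.add_mem_iff_right hab).mp h
    · exact ⟨b, hbU, hba, hb⟩
  · exact ⟨a, haU, ha, hab⟩

/-- Over a field of characteristic other than two, no space is a union of three proper subspaces. -/
theorem exists_notMem_three (h2 : (2 : F) ≠ 0) {U A B C : Submodule F V} (hA : ¬U ≤ A)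
    (hB : ¬U ≤ B) (hC : ¬U ≤ C) : ∃ v ∈ U, v ∉ A ∧ v ∉ B ∧ v ∉ C := by
  obtain ⟨x, hxU, hxA, hxB⟩ := exists_notMem_sup_two hA hB
  by_cases hxC : x ∈ C
  · obtain ⟨y, hyU, hyC⟩ := SetLike.not_le_iff_exists.mp hC
    -- The line `y + t x` misses `C` and meets each of `A` and `B` at most once, so its three points
    -- at `t = 0, 1, -1` cannot all lie in `A ∪ B`.
    have hmem : ∀ t : F, y + t • x ∈ U ∧ y + t • x ∉ C := fun t =>
      ⟨U.add_mem hyU (U.smul_mem t hxU),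
        fun h => hyC ((C.add_mem_iff_left (C.smul_mem t hxC)).mp h)⟩
    have huniq : ∀ (D : Submodule F V), x ∉ D → ∀ t s : F, y + t • x ∈ D → y + s • x ∈ D →
        t = s := by
      intro D hD t s ht hs
      by_contra hts
      have h := D.sub_mem ht hs
      rw [add_sub_add_left_eq_sub, ← sub_smul] at h
      exact hD ((D.smul_mem_iff (sub_ne_zero.mpr hts)).mp h)
    by_contra! hcon
    have hcov : ∀ t : F, y + t • x ∈ A ∨ y + t • x ∈ B := fun t => by
      by_contra! h
      exact (hmem t).2 (hcon _ (hmem t).1 h.1 h.2)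
    have h01 : (0 : F) ≠ 1 := zero_ne_one
    have h0m : (0 : F) ≠ -1 := (neg_ne_zero.mpr one_ne_zero).symm
    have h1m : (1 : F) ≠ -1 := fun h => h2 (by linear_combination h)
    rcases hcov 0 with h0 | h0 <;> rcases hcov 1 with h1 | h1 <;> rcases hcov (-1) with h3 | h3
    · exact h01 (huniq A hxA _ _ h0 h1)
    · exact h01 (huniq A hxA _ _ h0 h1)
    · exact h0m (huniq A hxA _ _ h0 h3)
    · exact h1m (huniq B hxB _ _ h1 h3)
    · exact h1m (huniq A hxA _ _ h1 h3)
    · exact h0m (huniq B hxB _ _ h0 h3)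
    · exact h01 (huniq B hxB _ _ h0 h1)
    · exact h01 (huniq B hxB _ _ h0 h1)
  · exact ⟨x, hxU, hxA, hxB, hxC⟩

theorem sup_span_singleton_inf_eq_bot {W L : Submodule F V} {v : V} (h : W ⊓ L = ⊥)
    (hv : v ∉ W ⊔ L) : (W ⊔ F ∙ v) ⊓ L = ⊥ := by
  rw [eq_bot_iff]
  rintro x ⟨hx, hxL⟩
  obtain ⟨w, hw, y, hy, rfl⟩ := Submodule.mem_sup.mp hx
  obtain ⟨c, rfl⟩ := Submodule.mem_span_singleton.mp hy
  by_cases hc : c = 0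
  · subst hc
    rw [zero_smul, add_zero] at hxL ⊢
    rw [← h]
    exact ⟨hw, hxL⟩
  · refine (hv ((Submodule.smul_mem_iff _ hc).mp ?_)).elim
    have : c • v = -w + (w + c • v) := by abel
    rw [this]
    exact Submodule.add_mem_sup (W.neg_mem hw) hxL

/-- The top exterior power is a line. Orientations become scalars in a basis, and the wedge pairing
becomes a determinant. -/
theorem exteriorPower_eq_smul_ιMulti {n : ℕ} {L : Type*} [AddCommGroup L] [Module F L]
    (b : Basis (Fin n) F L) (a : ⋀[F]^n L) :
    a = exteriorPower.alternatingMapLinearEquiv b.det a • exteriorPower.ιMulti F n b := by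
  have h : (LinearMap.id : ⋀[F]^n L →ₗ[F] ⋀[F]^n L) =
      (exteriorPower.alternatingMapLinearEquiv b.det).smulRight (exteriorPower.ιMulti F n b) := by
    refine exteriorPower.linearMap_ext (Basis.ext_alternating b fun i hi => ?_)
    let e : Equiv.Perm (Fin n) := Equiv.ofBijective i (Finite.injective_iff_bijective.mp hi)
    change exteriorPower.ιMulti F n (b ∘ e) =
      exteriorPower.alternatingMapLinearEquiv b.det (exteriorPower.ιMulti F n (b ∘ e)) •
        exteriorPower.ιMulti F n b
    rw [exteriorPower.alternatingMapLinearEquiv_apply_ιMulti, AlternatingMap.map_perm,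
      AlternatingMap.map_perm, Basis.det_self]
    rcases Int.units_eq_one_or (Equiv.Perm.sign e) with h | h
    · simp [h]
    · rw [h, Units.neg_smul, one_smul, Units.neg_smul, one_smul]
      exact (neg_one_smul F _).symm
  exact LinearMap.congr_fun h a

theorem ιMulti_basis_ne_zero {n : ℕ} {L : Type*} [AddCommGroup L] [Module F L]
    (b : Basis (Fin n) F L) : exteriorPower.ιMulti F n b ≠ 0 := by
  intro h
  have h1 := exteriorPower.alternatingMapLinearEquiv_apply_ιMulti b.det b
  rw [h, map_zero, Basis.det_self] at h1
  exact zero_ne_one h1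

variable {ω : V →ₗ[F] V →ₗ[F] F} {n : ℕ}

theorem OLag.isotropic (L : OLag ω n) {x y : V} (hx : x ∈ L.sub) (hy : y ∈ L.sub) : ω x y = 0 := by
  rw [← L.lagrangian] at hy
  exact hy x hx

theorem OLag.mem_of_forall (L : OLag ω n) {y : V} (h : ∀ x ∈ L.sub, ω x y = 0) : y ∈ L.sub := by
  rw [← L.lagrangian]
  exact h

theorem OLag.orthogonal_eq (L : OLag ω n) : LinearMap.BilinForm.orthogonal ω L.sub = L.sub :=
  L.lagrangian

theorem OLag.GenPos.symm {M L : OLag ω n} (h : M.GenPos L) : L.GenPos M := by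
  rw [OLag.GenPos, sup_comm]
  exact h

/-- The matrix of the pairing of two Lagrangians in given bases. -/
abbrev pairingMatrix (ω : V →ₗ[F] V →ₗ[F] F) {L M : Submodule F V} (l : Basis (Fin n) F L)
    (m : Basis (Fin n) F M) : Matrix (Fin n) (Fin n) F :=
  Matrix.of fun i j => ω (l i) (m j)

theorem pairingMatrix_swap_det (halt : ω.IsAlt) {L M : OLag ω n} (l : Basis (Fin n) F L.sub)
    (m : Basis (Fin n) F M.sub) :
    (pairingMatrix ω m l).det = (-1) ^ n * (pairingMatrix ω l m).det := by
  have : pairingMatrix ω m l = -(pairingMatrix ω l m).transpose := by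
    ext i j
    exact (halt.neg _ _).symm
  rw [this, Matrix.det_neg, Matrix.det_transpose, Fintype.card_fin]

variable [FiniteDimensional F V]

theorem OLag.finrank_eq (hn : finrank F V = 2 * n) (hnd : ω.Nondegenerate) (L : OLag ω n) :
    finrank F L.sub = n := by
  have h := LinearMap.BilinForm.finrank_orthogonal hnd L.sub
  have h2 := Submodule.finrank_le L.sub
  rw [L.orthogonal_eq] at h
  omega

theorem OLag.genPos_iff_disjoint (hn : finrank F V = 2 * n) (hnd : ω.Nondegenerate)
    {M L : OLag ω n} : M.GenPos L ↔ M.sub ⊓ L.sub = ⊥ := by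
  have h := Submodule.finrank_sup_add_finrank_inf_eq M.sub L.sub
  rw [M.finrank_eq hn hnd, L.finrank_eq hn hnd] at h
  constructor
  · intro h1
    rw [OLag.GenPos] at h1
    rw [h1, finrank_top] at h
    exact Submodule.finrank_eq_zero.mp (by omega)
  · intro h1
    rw [h1, finrank_bot] at h
    exact Submodule.eq_top_of_finrank_eq (by omega)

theorem OLag.GenPos.eq_zero (hn : finrank F V = 2 * n) (hnd : ω.Nondegenerate)
    {M L : OLag ω n} (h : M.GenPos L) {x : V} (hM : x ∈ M.sub) (hL : x ∈ L.sub) : x = 0 := by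
  have h1 := (OLag.genPos_iff_disjoint hn hnd).mp h
  have h2 : x ∈ M.sub ⊓ L.sub := ⟨hM, hL⟩
  rwa [h1, Submodule.mem_bot] at h2

/-- Dual to `(M + L)^⊥ ≤ M^⊥ ∩ L^⊥ = M ∩ L`. A vector outside `M + L` is therefore detected by some
element of `M ∩ L`. -/
theorem OLag.orthogonal_inf (hnd : ω.Nondegenerate) (halt : ω.IsAlt) (M L : OLag ω n) :
    LinearMap.BilinForm.orthogonal ω (M.sub ⊓ L.sub) ≤ M.sub ⊔ L.sub := by
  have h : LinearMap.BilinForm.orthogonal ω (M.sub ⊔ L.sub) ≤ M.sub ⊓ L.sub := by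
    refine le_inf ?_ ?_
    · conv_rhs => rw [← M.orthogonal_eq]
      exact LinearMap.BilinForm.orthogonal_le le_sup_left
    · conv_rhs => rw [← L.orthogonal_eq]
      exact LinearMap.BilinForm.orthogonal_le le_sup_right
  rw [← LinearMap.BilinForm.orthogonal_orthogonal hnd halt.isRefl (M.sub ⊔ L.sub)]
  exact LinearMap.BilinForm.orthogonal_le h

/-- Otherwise `(W + L)^⊥ ≤ W ∩ L = 0`, so `W + L = V`; then `dim W = n` and `W` would be Lagrangian.
-/
theorem not_orthogonal_le_sup (hn : finrank F V = 2 * n) (hnd : ω.Nondegenerate) (halt : ω.IsAlt)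
    {W : Submodule F V} (hW : W ≤ LinearMap.BilinForm.orthogonal ω W)
    (hW' : LinearMap.BilinForm.orthogonal ω W ≠ W) (L : OLag ω n) (hWL : W ⊓ L.sub = ⊥) :
    ¬LinearMap.BilinForm.orthogonal ω W ≤ W ⊔ L.sub := by
  intro h
  have h1 : LinearMap.BilinForm.orthogonal ω (W ⊔ L.sub) = ⊥ := by
    rw [eq_bot_iff, ← hWL]
    refine le_inf ?_ ?_
    · conv_rhs => rw [← LinearMap.BilinForm.orthogonal_orthogonal hnd halt.isRefl W]
      exact LinearMap.BilinForm.orthogonal_le h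
    · conv_rhs => rw [← L.orthogonal_eq]
      exact LinearMap.BilinForm.orthogonal_le le_sup_right
  have h2 := LinearMap.BilinForm.finrank_orthogonal hnd (W ⊔ L.sub)
  have h3 := Submodule.finrank_sup_add_finrank_inf_eq W L.sub
  have h4 := LinearMap.BilinForm.finrank_orthogonal hnd W
  have h5 := L.finrank_eq hn hnd
  have h6 := Submodule.finrank_le (W ⊔ L.sub)
  rw [h1, finrank_bot] at h2
  rw [hWL, finrank_bot] at h3
  exact hW' (Submodule.eq_of_le_of_finrank_eq hW (by omega)).symm

/-- Any three Lagrangians have a common Lagrangian complement. -/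
theorem exists_genPos_three (h2 : (2 : F) ≠ 0) (hn : finrank F V = 2 * n)
    (hnd : ω.Nondegenerate) (halt : ω.IsAlt) (A B C : OLag ω n) :
    ∃ P : OLag ω n, P.GenPos A ∧ P.GenPos B ∧ P.GenPos C := by
  -- A maximal isotropic subspace among those disjoint from `A`, `B`, `C` is Lagrangian: otherwise a
  -- vector of `W^⊥` outside `W + A`, `W + B`, `W + C` enlarges it.
  let S : Set (Submodule F V) := {W | W ≤ LinearMap.BilinForm.orthogonal ω W ∧
    W ⊓ A.sub = ⊥ ∧ W ⊓ B.sub = ⊥ ∧ W ⊓ C.sub = ⊥}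
  obtain ⟨W, ⟨hW, hA, hB, hC⟩, hmax⟩ := set_has_maximal_iff_noetherian.mpr
    (inferInstance : IsNoetherian F V) S ⟨⊥, bot_le, bot_inf_eq _, bot_inf_eq _, bot_inf_eq _⟩
  have hlag : LinearMap.BilinForm.orthogonal ω W = W := by
    by_contra hne
    obtain ⟨v, hv, hvA, hvB, hvC⟩ := exists_notMem_three h2
      (not_orthogonal_le_sup hn hnd halt hW hne A hA)
      (not_orthogonal_le_sup hn hnd halt hW hne B hB)
      (not_orthogonal_le_sup hn hnd halt hW hne C hC)
    refine hmax (W ⊔ F ∙ v) ⟨?_, sup_span_singleton_inf_eq_bot hA hvA,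
      sup_span_singleton_inf_eq_bot hB hvB, sup_span_singleton_inf_eq_bot hC hvC⟩ ?_
    · intro x hx y hy
      obtain ⟨w, hw, a, ha, rfl⟩ := Submodule.mem_sup.mp hx
      obtain ⟨w', hw', a', ha', rfl⟩ := Submodule.mem_sup.mp hy
      obtain ⟨c, rfl⟩ := Submodule.mem_span_singleton.mp ha
      obtain ⟨c', rfl⟩ := Submodule.mem_span_singleton.mp ha'
      have e1 : ω w' w = 0 := hW hw w' hw'
      have e2 : ω w' v = 0 := hv w' hw'
      have e3 : ω v w = 0 := halt.isRefl _ _ (hv w hw)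
      have e4 : ω v v = 0 := halt v
      change ω (w' + c' • v) (w + c • v) = 0
      simp [e1, e2, e3, e4]
    · refine lt_of_le_of_ne le_sup_left fun h => hvA ?_
      have : v ∈ W ⊔ F ∙ v := Submodule.mem_sup_right (Submodule.mem_span_singleton_self v)
      rw [← h] at this
      exact Submodule.mem_sup_left this
  have hrank : finrank F W = n := by
    have h := LinearMap.BilinForm.finrank_orthogonal hnd W
    have h' := Submodule.finrank_le W
    rw [hlag] at h
    omega
  let P : OLag ω n := ⟨W, hlag, exteriorPower.ιMulti F n (finBasisOfFinrankEq F W hrank),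
    ιMulti_basis_ne_zero _⟩
  exact ⟨P, (OLag.genPos_iff_disjoint hn hnd).mpr hA, (OLag.genPos_iff_disjoint hn hnd).mpr hB,
    (OLag.genPos_iff_disjoint hn hnd).mpr hC⟩

theorem OLag.exists_basis (hn : finrank F V = 2 * n) (hnd : ω.Nondegenerate) (L : OLag ω n) :
    ∃ (b : Basis (Fin n) F L.sub) (c : F), c ≠ 0 ∧ L.orient = c • exteriorPower.ιMulti F n b := by
  let b := finBasisOfFinrankEq F L.sub (L.finrank_eq hn hnd)
  have h := exteriorPower_eq_smul_ιMulti b L.orient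
  refine ⟨b, _, fun h0 => L.orient_ne_zero ?_, h⟩
  rw [h, h0, zero_smul]

/-- A null vector of the matrix gives an element of `L` orthogonal to `M`, hence in `L ∩ M = 0`. -/
theorem pairingMatrix_det_ne_zero (hn : finrank F V = 2 * n) (hnd : ω.Nondegenerate)
    (halt : ω.IsAlt) {L M : OLag ω n} (h : L.GenPos M) (l : Basis (Fin n) F L.sub)
    (m : Basis (Fin n) F M.sub) : (pairingMatrix ω l m).det ≠ 0 := by
  intro h0
  obtain ⟨c, hc, hc0⟩ := Matrix.exists_vecMul_eq_zero_iff.mpr h0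
  apply hc
  set v : L.sub := ∑ i, c i • l i with hv
  have hvM : (v : V) ∈ M.sub := by
    refine M.mem_of_forall fun x hx => halt.isRefl _ _ ?_
    have hlin : (ω.domRestrict₁₂ L.sub M.sub) v = 0 := by
      refine m.ext fun j => ?_
      have := congrFun hc0 j
      simpa [Matrix.vecMul, dotProduct, hv, LinearMap.domRestrict₁₂_apply] using this
    exact LinearMap.congr_fun hlin ⟨x, hx⟩
  have hv0 : v = 0 := Subtype.ext (h.eq_zero hn hnd v.2 hvM)
  rw [hv0] at hv
  exact funext fun i => (Fintype.linearIndependent_iff.mp l.linearIndependent c hv.symm i)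

/-- The projection of `M` to `L` along a common complement `P`. -/
theorem exists_projection (hn : finrank F V = 2 * n) (hnd : ω.Nondegenerate) {M P L : OLag ω n}
    (hPL : P.GenPos L) : ∃ φ : M.sub →ₗ[F] L.sub, ∀ m, (φ m : V) - m ∈ P.sub := by
  have hc : IsCompl L.sub P.sub :=
    ⟨disjoint_iff.mpr ((OLag.genPos_iff_disjoint hn hnd).mp hPL.symm),
      codisjoint_iff.mpr hPL.symm⟩
  refine ⟨(Submodule.projectionOnto L.sub P.sub hc).comp M.sub.subtype, fun m => ?_⟩
  rw [← Submodule.projectionOnto_apply_eq_zero_iff hc, map_sub,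
    Submodule.projectionOnto_apply_left, sub_eq_zero]
  rfl

end Transversals

/-! ### The constants of composites of normalized averages -/

section Constants

variable {F V : Type*} [Field F] [AddCommGroup V] [Module F V]
  {ω : V →ₗ[F] V →ₗ[F] F} {n : ℕ}

/-- Expand `ω(φ x - x, φ y - y) = 0`, using that `P`, `L` and `M` are all isotropic. -/
theorem projection_symm (halt : ω.IsAlt) {M P L : OLag ω n} (φ : M.sub →ₗ[F] L.sub)
    (hφ : ∀ m, (φ m : V) - m ∈ P.sub) (x y : M.sub) : ω (φ x) y = ω (φ y) x := by
  have h := P.isotropic (hφ x) (hφ y)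
  have h1 := L.isotropic (φ x).2 (φ y).2
  have h2 := M.isotropic x.2 y.2
  have h3 : -ω x (φ y) = ω (φ y) x := halt.neg _ _
  simp only [map_sub, LinearMap.sub_apply] at h
  linear_combination -h + h1 + h2 + h3

theorem coe_apply_basis_eq_sum {M L : Submodule F V} (φ : M →ₗ[F] L) (l : Basis (Fin n) F L)
    (m : Basis (Fin n) F M) (j : Fin n) :
    (φ (m j) : V) = ∑ k, LinearMap.toMatrix m l φ k j • (l k : V) := by
  refine (congrArg L.subtype (l.sum_repr (φ (m j)))).symm.trans ?_
  simp only [map_sum, map_smul, Submodule.subtype_apply, LinearMap.toMatrix_apply]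

/-- `ω(p, m) = ω(p, φ m)` because `φ m - m` lies in the isotropic `P`. -/
theorem pairingMatrix_projection {M P L : OLag ω n} (φ : M.sub →ₗ[F] L.sub)
    (hφ : ∀ m, (φ m : V) - m ∈ P.sub) (p : Basis (Fin n) F P.sub) (l : Basis (Fin n) F L.sub)
    (m : Basis (Fin n) F M.sub) :
    (pairingMatrix ω p m).det = (pairingMatrix ω p l).det * (LinearMap.toMatrix m l φ).det := by
  rw [← Matrix.det_mul]
  congr 1
  ext i j
  have h := P.isotropic (p i).2 (hφ (m j))
  rw [map_sub, sub_eq_zero] at h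
  rw [Matrix.mul_apply]
  change ω (p i : V) (m j) = _
  rw [← h, coe_apply_basis_eq_sum φ l m, map_sum]
  refine Finset.sum_congr rfl fun k _ => ?_
  rw [map_smul, smul_eq_mul, mul_comm]
  rfl

theorem pairingMatrix_comp {M L : OLag ω n} (φ : M.sub →ₗ[F] L.sub)
    (l : Basis (Fin n) F L.sub) (m : Basis (Fin n) F M.sub) :
    (LinearMap.BilinForm.toMatrix m ((ω.domRestrict₁₂ L.sub M.sub).comp φ)).det =
      (LinearMap.toMatrix m l φ).det * (pairingMatrix ω l m).det := by
  rw [← Matrix.det_transpose (LinearMap.toMatrix m l φ), ← Matrix.det_mul]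
  congr 1
  ext i j
  rw [LinearMap.BilinForm.toMatrix_apply, Matrix.mul_apply]
  change ω (φ (m i) : V) (m j) = _
  rw [coe_apply_basis_eq_sum φ l m, map_sum, LinearMap.sum_apply]
  refine Finset.sum_congr rfl fun k _ => ?_
  rw [map_smul, LinearMap.smul_apply, Matrix.transpose_apply, smul_eq_mul]
  rfl

theorem toMatrix_projection_det_ne_zero [FiniteDimensional F V]
    (hn : finrank F V = 2 * n) (hnd : ω.Nondegenerate)
    (halt : ω.IsAlt) {M P L : OLag ω n} (hPM : P.GenPos M)
    (φ : M.sub →ₗ[F] L.sub) (hφ : ∀ m, (φ m : V) - m ∈ P.sub)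
    (l : Basis (Fin n) F L.sub) (m : Basis (Fin n) F M.sub) :
    (LinearMap.toMatrix m l φ).det ≠ 0 := by
  have h := pairingMatrix_det_ne_zero hn hnd halt hPM
    (finBasisOfFinrankEq F P.sub (P.finrank_eq hn hnd)) m
  rw [pairingMatrix_projection φ hφ _ l m] at h
  exact right_ne_zero_of_mul h

variable [Fintype F] {ψ : AddChar F ℂ}

theorem normConst_eq {M L : OLag ω n} (l : Basis (Fin n) F L.sub) (m : Basis (Fin n) F M.sub)
    {cl cm : F} (hl : L.orient = cl • exteriorPower.ιMulti F n l)
    (hm : M.orient = cm • exteriorPower.ιMulti F n m) :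
    normConst ψ M L = (gaussSumOne ψ / Fintype.card F) ^ n *
      complexQuadraticChar (cl * cm * (pairingMatrix ω l m).det) := by
  have h := wedgePairing_ιMulti L M l m
  have h1 : (-1) ^ n.choose 2 * wedgePairing L M L.orient M.orient =
      cl * cm * (pairingMatrix ω l m).det := by
    have h2 : wedgePairing L M L.orient M.orient =
        cl * cm * wedgePairing L M (exteriorPower.ιMulti F n l) (exteriorPower.ιMulti F n m) := by
      rw [hl, hm]
      simp only [wedgePairing, map_smul, LinearMap.smul_apply, smul_eq_mul]
      ring
    have h3 : ((-1 : F) ^ n.choose 2) * (-1) ^ n.choose 2 = 1 := by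
      rw [← mul_pow]
      simp
    rw [h2, h]
    linear_combination cl * cm * (pairingMatrix ω l m).det * h3
  rw [normConst, h1]
  rfl

variable [FiniteDimensional F V]

/-- The basis and orientation of `P` enter only through a square, so `P` survives only in `det φ`;
the sign `(-1) ^ n` comes from exchanging the arguments of `ω`. -/
theorem normConst_mul_normConst (hn : finrank F V = 2 * n) (hnd : ω.Nondegenerate)
    (halt : ω.IsAlt) {M P L : OLag ω n} (hPL : P.GenPos L)
    (φ : M.sub →ₗ[F] L.sub) (hφ : ∀ m, (φ m : V) - m ∈ P.sub)
    (l : Basis (Fin n) F L.sub) (m : Basis (Fin n) F M.sub)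
    {cl cm : F} (hl : L.orient = cl • exteriorPower.ιMulti F n l)
    (hm : M.orient = cm • exteriorPower.ιMulti F n m) :
    normConst ψ M P * normConst ψ P L = (gaussSumOne ψ / Fintype.card F) ^ n *
      (gaussSumOne ψ / Fintype.card F) ^ n *
      complexQuadraticChar ((-1) ^ n * (cl * cm * (LinearMap.toMatrix m l φ).det)) := by
  obtain ⟨p, cp, hcp, hp⟩ := P.exists_basis hn hnd
  have h := mul_ne_zero hcp (pairingMatrix_det_ne_zero hn hnd halt hPL p l)
  rw [normConst_eq p m hp hm, normConst_eq l p hl hp, mul_mul_mul_comm,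
    ← complexQuadraticChar_mul, pairingMatrix_projection φ hφ p l m, pairingMatrix_swap_det halt p l,
    ← complexQuadraticChar_mul_mul_self h ((-1) ^ n * _)]
  congr 2
  ring

/-- The value at `1` of the composite of the normalized averages along `L`, `P`, `M`, applied to the
delta function of `L`. -/
def compositeConst (ψ : AddChar F ℂ) {M L : OLag ω n} (P : OLag ω n) [Fintype M.sub]
    (φ : M.sub →ₗ[F] L.sub) : ℂ :=
  normConst ψ M P * normConst ψ P L * ∑ m : M.sub, ψ (2⁻¹ * ω (φ m) m)

theorem compositeConst_eq (hq : Odd (Fintype.card F)) (hψ : ψ ≠ 1)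
    (hn : finrank F V = 2 * n) (hnd : ω.Nondegenerate)
    (halt : ω.IsAlt) {M L P P' : OLag ω n} [Fintype M.sub] (hPM : P.GenPos M) (hPL : P.GenPos L)
    (hPM' : P'.GenPos M) (hPL' : P'.GenPos L)
    (φ : M.sub →ₗ[F] L.sub) (hφ : ∀ m, (φ m : V) - m ∈ P.sub)
    (φ' : M.sub →ₗ[F] L.sub) (hφ' : ∀ m, (φ' m : V) - m ∈ P'.sub) :
    compositeConst ψ P' φ' = compositeConst ψ P φ := by
  obtain ⟨l, cl, hcl, hl⟩ := L.exists_basis hn hnd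
  obtain ⟨m, cm, hcm, hm⟩ := M.exists_basis hn hnd
  have hinj : Function.Injective φ := by
    rw [injective_iff_map_eq_zero]
    intro x hx
    have h := hφ x
    rw [hx, Submodule.coe_zero, zero_sub, P.sub.neg_mem_iff] at h
    exact Subtype.ext (hPM.eq_zero hn hnd h x.2)
  let e := φ.linearEquivOfInjective hinj ((M.finrank_eq hn hnd).trans (L.finrank_eq hn hnd).symm)
  have he : ∀ y, φ (e.symm y) = y := fun y => e.apply_symm_apply y
  -- Here `u = φ⁻¹ ∘ φ'`, so that `φ' = φ ∘ u`.
  let u : M.sub →ₗ[F] M.sub := e.symm.toLinearMap.comp φ'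
  have hu : ∀ x, φ (u x) = φ' x := fun x => he (φ' x)
  have hφu : φ' = φ.comp u := LinearMap.ext fun x => (hu x).symm
  have hdet : (LinearMap.toMatrix m l φ').det =
      (LinearMap.toMatrix m l φ).det * LinearMap.det u := by
    rw [hφu, LinearMap.toMatrix_comp m m l, Matrix.det_mul, LinearMap.det_toMatrix]
  have hne := toMatrix_projection_det_ne_zero hn hnd halt hPM' φ' hφ' l m
  rw [hdet] at hne
  have hudet : LinearMap.det u ≠ 0 := right_ne_zero_of_mul hne
  let B : LinearMap.BilinForm F M.sub := (ω.domRestrict₁₂ L.sub M.sub).comp φ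
  have hB : ∀ x y, B x y = ω (φ x) y := fun _ _ => rfl
  have hg := sum_addChar_bilinForm_compLeft hq hψ (B := B)
    ⟨fun x y => projection_symm halt φ hφ x y⟩ u
    (fun x y => by
      rw [hB, hB, hu, hu]
      exact projection_symm halt φ' hφ' x y)
    -- A vector of the radical lies in `M ∩ L`, where both projections are the identity.
    (fun x hx => by
      have h1 : (φ x : V) ∈ M.sub := M.mem_of_forall fun y hy => halt.isRefl _ _ (by
        exact LinearMap.congr_fun hx ⟨y, hy⟩)
      have h2 : (φ x : V) = x :=
        sub_eq_zero.mp (hPM.eq_zero hn hnd (hφ x) (M.sub.sub_mem h1 x.2))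
      have h3 : (x : V) ∈ L.sub := h2 ▸ (φ x).2
      have h4 : (φ' x : V) = x :=
        sub_eq_zero.mp (hPL'.eq_zero hn hnd (hφ' x) (L.sub.sub_mem (φ' x).2 h3))
      apply hinj
      rw [hu]
      exact Subtype.ext (h4.trans h2.symm))
    hudet
  simp only [hB, hu] at hg
  rw [compositeConst, compositeConst, hg, normConst_mul_normConst hn hnd halt hPL' φ' hφ' l m hl hm,
    normConst_mul_normConst hn hnd halt hPL φ hφ l m hl hm, hdet, ← mul_assoc _ _ (LinearMap.det u),
    ← mul_assoc _ _ (LinearMap.det u), complexQuadraticChar_mul _ (LinearMap.det u)]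
  -- The orientation sign and the Gauss sum each contribute `σ(det u)`, and these cancel.
  linear_combination (gaussSumOne ψ / Fintype.card F) ^ n * (gaussSumOne ψ / Fintype.card F) ^ n *
      complexQuadraticChar ((-1) ^ n * (cl * cm * (LinearMap.toMatrix m l φ).det)) *
      (∑ m, ψ (2⁻¹ * ω (φ m) m)) * complexQuadraticChar_mul_self hudet

theorem gaussSumOne_div_pow (hq : Odd (Fintype.card F)) (hψ : ψ ≠ 1) :
    (gaussSumOne ψ / Fintype.card F) ^ n * (gaussSumOne ψ / Fintype.card F) ^ n *
      complexQuadraticChar ((-1 : F) ^ n) * (Fintype.card F : ℂ) ^ n = 1 := by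
  have hc : (Fintype.card F : ℂ) ≠ 0 := Nat.cast_ne_zero.mpr Fintype.card_ne_zero
  have h := gaussSumOne_sq hq hψ
  have h1 := complexQuadraticChar_mul_self (neg_ne_zero.mpr (one_ne_zero (α := F)))
  rw [complexQuadraticChar_pow, ← mul_pow, ← mul_pow, ← mul_pow]
  have : gaussSumOne ψ / Fintype.card F * (gaussSumOne ψ / Fintype.card F) *
      complexQuadraticChar (-1 : F) * (Fintype.card F : ℂ) = 1 := by
    field_simp
    rw [h]
    linear_combination (Fintype.card F : ℂ) * h1
  rw [this, one_pow]

/-- For transversal `M` and `L` the form is nondegenerate with discriminant `det φ * det (ω lᵢ mⱼ)`.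
The factor `σ(det φ)` cancels against the orientation sign, and `gaussSumOne_div_pow` absorbs the
surplus powers of `G₁`. -/
theorem compositeConst_eq_normConst (hq : Odd (Fintype.card F)) (hψ : ψ ≠ 1)
    (hn : finrank F V = 2 * n) (hnd : ω.Nondegenerate)
    (halt : ω.IsAlt) {M L P : OLag ω n} [Fintype M.sub] (hPM : P.GenPos M) (hPL : P.GenPos L)
    (hML : M.GenPos L) (φ : M.sub →ₗ[F] L.sub) (hφ : ∀ m, (φ m : V) - m ∈ P.sub) :
    compositeConst ψ P φ = normConst ψ M L := by
  obtain ⟨l, cl, hcl, hl⟩ := L.exists_basis hn hnd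
  obtain ⟨m, cm, hcm, hm⟩ := M.exists_basis hn hnd
  let B : LinearMap.BilinForm F M.sub := (ω.domRestrict₁₂ L.sub M.sub).comp φ
  have hB : ∀ x y, B x y = ω (φ x) y := fun _ _ => rfl
  have hdet := pairingMatrix_comp φ l m
  have hne := toMatrix_projection_det_ne_zero hn hnd halt hPM φ hφ l m
  have hg := sum_addChar_bilinForm hq hψ (B := B)
    ⟨fun x y => projection_symm halt φ hφ x y⟩ m (by
      rw [hdet]
      exact mul_ne_zero hne (pairingMatrix_det_ne_zero hn hnd halt hML.symm l m))
  simp only [hB] at hg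
  rw [hdet] at hg
  have hc : (Fintype.card F : ℂ) ≠ 0 := Nat.cast_ne_zero.mpr Fintype.card_ne_zero
  have h1 := gaussSumOne_div_pow (n := n) hq hψ
  have h2 : gaussSumOne ψ ^ n = (gaussSumOne ψ / Fintype.card F) ^ n * (Fintype.card F : ℂ) ^ n := by
    rw [← mul_pow, div_mul_cancel₀ _ hc]
  have h3 := complexQuadraticChar_mul_self hne
  rw [compositeConst, hg, normConst_mul_normConst hn hnd halt hPL φ hφ l m hl hm,
    normConst_eq l m hl hm, h2]
  simp only [complexQuadraticChar_mul] at h1 ⊢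
  generalize complexQuadraticChar (LinearMap.toMatrix m l φ).det = D at *
  generalize gaussSumOne ψ / Fintype.card F = g at *
  generalize (Fintype.card F : ℂ) ^ n = Q at *
  generalize complexQuadraticChar (pairingMatrix ω l m).det = R at *
  generalize complexQuadraticChar ((-1 : F) ^ n) = E at *
  linear_combination g ^ n * complexQuadraticChar cl * complexQuadraticChar cm * R * D * D * h1 +
    g ^ n * complexQuadraticChar cl * complexQuadraticChar cm * R * h3

theorem compositeConst_self (hq : Odd (Fintype.card F)) (hψ : ψ ≠ 1)
    (hn : finrank F V = 2 * n) (hnd : ω.Nondegenerate)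
    (halt : ω.IsAlt) {M P : OLag ω n} [Fintype M.sub] (hPM : P.GenPos M) :
    compositeConst ψ P (LinearMap.id : M.sub →ₗ[F] M.sub) = 1 := by
  obtain ⟨m, cm, hcm, hm⟩ := M.exists_basis hn hnd
  have hsum : ∑ x : M.sub, ψ (2⁻¹ * ω ((LinearMap.id : M.sub →ₗ[F] M.sub) x) x) =
      (Fintype.card F : ℂ) ^ n := by
    have : ∀ x : M.sub, ψ (2⁻¹ * ω ((LinearMap.id : M.sub →ₗ[F] M.sub) x) x) = 1 := fun x => by
      rw [LinearMap.id_apply, M.isotropic x.2 x.2, mul_zero, AddChar.map_zero_eq_one]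
    rw [Finset.sum_congr rfl fun x _ => this x, Finset.sum_const, Finset.card_univ,
      Module.card_eq_pow_finrank (K := F), M.finrank_eq hn hnd]
    simp
  rw [compositeConst, hsum, normConst_mul_normConst hn hnd halt hPM LinearMap.id
    (fun x => by simp) m m hm hm, LinearMap.toMatrix_id, Matrix.det_one, mul_one,
    complexQuadraticChar_mul_mul_self hcm]
  exact gaussSumOne_div_pow hq hψ

end Constants

open Heisenberg

/-! ### Convolution over a subgroup as a sum over the group -/

section Convolution

variable {G : Type*} [Group G]

/-- The map `g ↦ [(h g⁻¹, g)]` covers the fibre of multiplication over `h`, and its own fibres are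
right cosets `P b`. -/
theorem conv_eq_sum [Fintype G] (P : Subgroup G) (k f : G → ℂ)
    (hkf : ∀ a b, ∀ x ∈ P, k (a * x) * f (x⁻¹ * b) = k a * f b) (h : G) :
    (Nat.card P : ℂ) * conv P k f h = ∑ g : G, k (h * g⁻¹) * f g := by
  classical
  have : Finite (BalancedProduct P) := Quotient.finite _
  have : Fintype {y : BalancedProduct P // y.mulMap = h} := Fintype.ofFinite _
  let q : G → {y : BalancedProduct P // y.mulMap = h} := fun g =>
    ⟨Quotient.mk (balancedSetoid P) (h * g⁻¹, g), by simp [BalancedProduct.mulMap]⟩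
  have hq : ∀ g b, q g = q b ↔ g * b⁻¹ ∈ P := by
    intro g b
    refine Subtype.ext_iff.trans (Quotient.eq.trans ⟨?_, fun hx => ⟨g * b⁻¹, hx, ?_⟩⟩)
    · rintro ⟨x, hx, hxe⟩
      have h2 : b = x⁻¹ * g := congrArg Prod.snd hxe
      rw [h2]
      simpa using hx
    · simp [mul_assoc]
  have hfib : ∀ y, ((Finset.univ.filter fun g => q g = y).card : ℂ) = Nat.card P := by
    rintro ⟨y, hy⟩
    obtain ⟨⟨a, b⟩, rfl⟩ := Quotient.exists_rep y
    have hab : a * b = h := hy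
    have hyb : (⟨Quotient.mk (balancedSetoid P) (a, b), hy⟩ :
        {y : BalancedProduct P // y.mulMap = h}) = q b := by
      subst hab
      simp [q]
    rw [hyb, ← Fintype.card_subtype, ← Nat.card_eq_fintype_card]
    congr 1
    exact Nat.card_congr
      { toFun := fun g => ⟨g.1 * b⁻¹, (hq _ _).mp g.2⟩
        invFun := fun x => ⟨x.1 * b, (hq _ _).mpr (by simp)⟩
        left_inv := fun g => by simp
        right_inv := fun x => by simp }
  rw [conv, finsum_eq_sum_of_fintype, Finset.mul_sum,
    ← Finset.sum_fiberwise (s := Finset.univ) (g := q)]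
  refine Finset.sum_congr rfl fun y _ => ?_
  rw [Finset.sum_congr rfl (g := fun _ => descent P k f y.1), Finset.sum_const, nsmul_eq_mul, hfib]
  intro g hg
  rw [← (Finset.mem_filter.mp hg).2]
  exact (descent_mk P k f hkf _ _).symm

end Convolution

/-! ### Delta functions, and intertwiners as convolution operators -/

section Heisenberg

variable {F V : Type*} [Field F] [AddCommGroup V] [Module F V]
  {ω : V →ₗ[F] V →ₗ[F] F} {n : ℕ} {ψ : AddChar F ℂ}

instance [Finite F] [Finite V] : Finite (Heisenberg ω) :=
  Finite.of_injective (fun h => (h.vec, h.cen)) fun _ _ h =>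
    Heisenberg.ext (congrArg Prod.fst h) (congrArg Prod.snd h)

theorem ofCen_mul_comm (z : F) (h : Heisenberg ω) : ofCen ω z * h = h * ofCen ω z := by
  ext <;> simp [ofCen, add_comm]

theorem ofCen_mul_ofVec (h : Heisenberg ω) : ofCen ω h.cen * ofVec ω h.vec = h := by
  ext <;> simp [ofCen, ofVec]

theorem cen_inv_of_isAlt (halt : ω.IsAlt) (h : Heisenberg ω) : (h⁻¹).cen = -h.cen := by
  rw [cen_inv, halt.self_eq_zero, mul_zero, add_zero]

theorem addChar_neg_mul (z : F) : ψ (-z) * ψ z = 1 := by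
  rw [← AddChar.map_add_eq_mul, neg_add_cancel, AddChar.map_zero_eq_one]

theorem model_apply_mul {L : OLag ω n} (f : model ψ L) {x : Heisenberg ω} (hx : x.vec ∈ L.sub)
    (h : Heisenberg ω) : f.1 (x * h) = ψ x.cen * f.1 h := by
  conv_lhs => rw [← ofCen_mul_ofVec x, mul_assoc]
  rw [f.2.1, f.2.2 _ hx]

theorem kernelSpace_apply_mul {M L : OLag ω n} {k : Heisenberg ω → ℂ} (hk : k ∈ kernelSpace ψ M L)
    {x : Heisenberg ω} (hx : x.vec ∈ L.sub) (h : Heisenberg ω) : k (h * x) = ψ x.cen * k h := by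
  have h1 : h * x = ofCen ω x.cen * (ofVec ω 0 * h * ofVec ω x.vec) := by
    have : ofVec ω (0 : V) = 1 := rfl
    rw [this, one_mul, ← mul_assoc, ofCen_mul_comm, mul_assoc, ofCen_mul_ofVec]
  rw [h1, hk.1, hk.2 0 M.sub.zero_mem _ hx]

theorem mem_model_of_mem_kernelSpace {M L : OLag ω n} {k : Heisenberg ω → ℂ}
    (hk : k ∈ kernelSpace ψ M L) : k ∈ model ψ M := by
  refine ⟨hk.1, fun m hm h => ?_⟩
  have := hk.2 m hm 0 L.sub.zero_mem h
  have h1 : ofVec ω (0 : V) = 1 := rfl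
  rwa [h1, mul_one] at this

theorem mem_kernelSpace {M L : OLag ω n} (f : model ψ M)
    (hf : ∀ x : Heisenberg ω, x.vec ∈ L.sub → ∀ h, f.1 (h * x) = ψ x.cen * f.1 h) :
    f.1 ∈ kernelSpace ψ M L := by
  refine ⟨f.2.1, fun m hm l hl h => ?_⟩
  rw [hf (ofVec ω l) hl, f.2.2 m hm]
  simp [ofVec]

open scoped Classical in
/-- The element of the model `ℋ_L` supported on `Z · L` with value `1` at `1`. -/
def deltaFun (ψ : AddChar F ℂ) (L : OLag ω n) (h : Heisenberg ω) : ℂ :=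
  if h.vec ∈ L.sub then ψ h.cen else 0

theorem deltaFun_of_mem {L : OLag ω n} {h : Heisenberg ω} (hh : h.vec ∈ L.sub) :
    deltaFun ψ L h = ψ h.cen := if_pos hh

theorem deltaFun_of_notMem {L : OLag ω n} {h : Heisenberg ω} (hh : h.vec ∉ L.sub) :
    deltaFun ψ L h = 0 := if_neg hh

theorem deltaFun_mul_left {L : OLag ω n} {x : Heisenberg ω} (hx : x.vec ∈ L.sub)
    (h : Heisenberg ω) : deltaFun ψ L (x * h) = ψ x.cen * deltaFun ψ L h := by
  by_cases hh : h.vec ∈ L.sub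
  · rw [deltaFun_of_mem hh, deltaFun_of_mem (L.sub.add_mem hx hh), cen_mul, L.isotropic hx hh,
      mul_zero, add_zero, AddChar.map_add_eq_mul]
  · rw [deltaFun_of_notMem hh, deltaFun_of_notMem, mul_zero]
    rwa [vec_mul, L.sub.add_mem_iff_right hx]

theorem deltaFun_mul_right {L : OLag ω n} {x : Heisenberg ω} (hx : x.vec ∈ L.sub)
    (h : Heisenberg ω) : deltaFun ψ L (h * x) = ψ x.cen * deltaFun ψ L h := by
  by_cases hh : h.vec ∈ L.sub
  · rw [deltaFun_of_mem hh, deltaFun_of_mem (L.sub.add_mem hh hx), cen_mul, L.isotropic hh hx,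
      mul_zero, add_zero, AddChar.map_add_eq_mul, mul_comm]
  · rw [deltaFun_of_notMem hh, deltaFun_of_notMem, mul_zero]
    rwa [vec_mul, L.sub.add_mem_iff_left hx]

/-- The delta function as an element of the model `ℋ_L`. -/
def delta (ψ : AddChar F ℂ) (L : OLag ω n) : model ψ L :=
  ⟨deltaFun ψ L, fun z h => deltaFun_mul_left (x := ofCen ω z) L.sub.zero_mem h, fun l hl h => by
    rw [deltaFun_mul_left (x := ofVec ω l) hl]
    simp [ofVec]⟩

/-- `Z · L` acts on `δ_L` through a character, and an intertwiner preserves this. -/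
theorem intertwiner_delta_mem {M L : OLag ω n}
    (T : Representation.IntertwiningMap (heisRep ψ L) (heisRep ψ M)) :
    (T (delta ψ L)).1 ∈ kernelSpace ψ M L := by
  refine mem_kernelSpace _ fun x hx h => ?_
  have h1 : heisRep ψ L x (delta ψ L) = ψ x.cen • delta ψ L :=
    Subtype.ext (funext fun h => deltaFun_mul_right hx h)
  have h2 := T.isIntertwining _ _ x (delta ψ L)
  rw [h1, map_smul] at h2
  exact (congrFun (congrArg Subtype.val h2) h).symm

theorem kernel_mul_model (halt : ω.IsAlt) {M L : OLag ω n} {k : Heisenberg ω → ℂ}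
    (hk : k ∈ kernelSpace ψ M L) (f : model ψ L) (a b x : Heisenberg ω) (hx : x ∈ L.zSubgroup) :
    k (a * x) * f.1 (x⁻¹ * b) = k a * f.1 b := by
  rw [kernelSpace_apply_mul hk hx, model_apply_mul f (L.zSubgroup.inv_mem hx),
    cen_inv_of_isAlt halt]
  linear_combination k a * f.1 b * addChar_neg_mul (ψ := ψ) x.cen

/-- Over `M + L` every value is a multiple of `k 1`. Elsewhere some `y ∈ M ∩ L` commutes with `h`
only up to a central element on which `ψ` is nontrivial; invariance under `y` on both sides then
forces `k h = 0`. -/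
theorem kernelSpace_eq_zero [FiniteDimensional F V] (h2 : (2 : F) ≠ 0) (hnd : ω.Nondegenerate)
    (halt : ω.IsAlt) (hψ : ψ ≠ 1) {M L : OLag ω n}
    {k : Heisenberg ω → ℂ}
    (hk : k ∈ kernelSpace ψ M L) (h1 : k 1 = 0) : k = 0 := by
  funext h
  by_cases hh : h.vec ∈ M.sub ⊔ L.sub
  · obtain ⟨m, hm, l, hl, hml⟩ := Submodule.mem_sup.mp hh
    have e : h = ofCen ω (h.cen - 2⁻¹ * ω m l) * (ofVec ω m * 1 * ofVec ω l) := by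
      ext
      · simp [ofCen, ofVec, hml]
      · simp [ofCen, ofVec]
    rw [e, hk.1, hk.2 m hm l hl, h1, mul_zero]
    rfl
  · have hx : ∃ x ∈ M.sub ⊓ L.sub, ω x h.vec ≠ 0 := by
      by_contra! hcon
      exact hh (OLag.orthogonal_inf hnd halt M L hcon)
    obtain ⟨x, hx, hx0⟩ := hx
    obtain ⟨z, hz⟩ := (AddChar.ne_one_iff).mp hψ
    let y := (z / ω x h.vec) • x
    have hy : y ∈ M.sub ⊓ L.sub := Submodule.smul_mem _ _ hx
    have hyz : ω y h.vec = z := by simp [y, hx0]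
    have e : ofVec ω y * h = ofCen ω z * (h * ofVec ω y) := by
      ext
      · simp [ofCen, ofVec, add_comm]
      · have h3 : ω h.vec y = -z := by rw [← hyz, halt.neg]
        have h4 : (2 : F)⁻¹ * 2 = 1 := inv_mul_cancel₀ h2
        simp only [ofCen, ofVec, cen_mul, map_zero, LinearMap.zero_apply, hyz, h3]
        linear_combination z * h4
    have e1 := (mem_model_of_mem_kernelSpace hk).2 y hy.1 h
    rw [e, hk.1, kernelSpace_apply_mul hk hy.2] at e1
    have e2 : ψ (ofVec ω y).cen = 1 := AddChar.map_zero_eq_one ψ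
    rw [e2, one_mul] at e1
    have e3 : (ψ z - 1) * k h = 0 := by linear_combination e1
    exact (mul_eq_zero.mp e3).resolve_left (sub_ne_zero.mpr hz)

variable [Finite F] [Finite V]

/-- `δ_L` generates `ℋ_L`: this writes `f` as an explicit combination of its translates, so an
intertwiner is known from its value on `δ_L`. -/
theorem card_smul_model (halt : ω.IsAlt) {L : OLag ω n} [Fintype (Heisenberg ω)] (f : model ψ L) :
    (Nat.card L.zSubgroup : ℂ) • f = ∑ g, f.1 g • heisRep ψ L g⁻¹ (delta ψ L) := by
  classical
  refine Subtype.ext (funext fun h => ?_)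
  have h1 : (∑ g, f.1 g • heisRep ψ L g⁻¹ (delta ψ L)).1 h =
      ∑ g, f.1 g * deltaFun ψ L (h * g⁻¹) := by
    rw [AddSubmonoidClass.coe_finsetSum, Finset.sum_apply]
    rfl
  rw [h1]
  have hP : Fintype L.zSubgroup := Fintype.ofFinite _
  change (Nat.card L.zSubgroup : ℂ) * f.1 h = _
  have h2 : ∀ x : Heisenberg ω, f.1 (x⁻¹ * h) * deltaFun ψ L x =
      if x ∈ L.zSubgroup then f.1 h else 0 := by
    intro x
    split_ifs with hx
    · rw [deltaFun_of_mem hx, model_apply_mul f (L.zSubgroup.inv_mem hx), cen_inv_of_isAlt halt]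
      linear_combination f.1 h * addChar_neg_mul (ψ := ψ) x.cen
    · rw [deltaFun_of_notMem hx, mul_zero]
  rw [← Fintype.sum_equiv ((Equiv.inv (Heisenberg ω)).trans (Equiv.mulRight h))
    (fun x => f.1 (x⁻¹ * h) * deltaFun ψ L x) _ (fun x => by simp)]
  simp_rw [h2]
  rw [Finset.sum_ite, Finset.sum_const, Finset.sum_const_zero, add_zero, nsmul_eq_mul,
    ← Fintype.card_subtype, Nat.card_eq_fintype_card]

theorem zSubgroup_card_ne_zero (L : OLag ω n) : (Nat.card L.zSubgroup : ℂ) ≠ 0 :=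
  Nat.cast_ne_zero.mpr Nat.card_pos.ne'

theorem intertwiner_apply_eq_conv (halt : ω.IsAlt) {M L : OLag ω n}
    (T : Representation.IntertwiningMap (heisRep ψ L) (heisRep ψ M)) (f : model ψ L) :
    (T f).1 = conv L.zSubgroup (T (delta ψ L)).1 f.1 := by
  have : Fintype (Heisenberg ω) := Fintype.ofFinite _
  funext h
  apply mul_left_cancel₀ (zSubgroup_card_ne_zero L)
  rw [conv_eq_sum _ _ _ (fun a b x hx =>
    kernel_mul_model halt (intertwiner_delta_mem T) f a b x hx)]
  have h1 := congrArg T (card_smul_model halt f)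
  rw [map_smul, map_sum] at h1
  have h2 := congrFun (congrArg Subtype.val h1) h
  rw [AddSubmonoidClass.coe_finsetSum, Finset.sum_apply] at h2
  refine h2.trans (Finset.sum_congr rfl fun g _ => ?_)
  rw [map_smul, T.isIntertwining, mul_comm]
  rfl

theorem conv_delta (halt : ω.IsAlt) {M L : OLag ω n} {k : Heisenberg ω → ℂ}
    (hk : k ∈ kernelSpace ψ M L) : conv L.zSubgroup k (delta ψ L).1 = k := by
  classical
  have : Fintype (Heisenberg ω) := Fintype.ofFinite _
  have hP : Fintype L.zSubgroup := Fintype.ofFinite _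
  funext h
  apply mul_left_cancel₀ (zSubgroup_card_ne_zero L)
  rw [conv_eq_sum _ _ _ (fun a b x hx => kernel_mul_model halt hk _ a b x hx)]
  have h2 : ∀ x : Heisenberg ω, k (h * x⁻¹) * (delta ψ L).1 x =
      if x ∈ L.zSubgroup then k h else 0 := by
    intro x
    change _ * deltaFun ψ L x = _
    split_ifs with hx
    · rw [deltaFun_of_mem hx, kernelSpace_apply_mul hk (L.zSubgroup.inv_mem hx),
        cen_inv_of_isAlt halt]
      linear_combination k h * addChar_neg_mul (ψ := ψ) x.cen
    · rw [deltaFun_of_notMem hx, mul_zero]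
  simp_rw [h2]
  rw [Finset.sum_ite, Finset.sum_const, Finset.sum_const_zero, add_zero, nsmul_eq_mul,
    ← Fintype.card_subtype, Nat.card_eq_fintype_card]

/-- An intertwining morphism is determined by one number. -/
theorem intertwiner_ext [FiniteDimensional F V] (h2 : (2 : F) ≠ 0) (hnd : ω.Nondegenerate)
    (halt : ω.IsAlt) (hψ : ψ ≠ 1) {M L : OLag ω n}
    {T T' : Representation.IntertwiningMap (heisRep ψ L) (heisRep ψ M)}
    (h : (T (delta ψ L)).1 1 = (T' (delta ψ L)).1 1) : T = T' := by
  have h1 := kernelSpace_eq_zero h2 hnd halt hψ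
    (Submodule.sub_mem _ (intertwiner_delta_mem T) (intertwiner_delta_mem T'))
    (by rw [Pi.sub_apply, h, sub_self])
  rw [sub_eq_zero] at h1
  refine DFunLike.ext _ _ fun f => Subtype.ext ?_
  rw [intertwiner_apply_eq_conv halt T, intertwiner_apply_eq_conv halt T', h1]

end Heisenberg

/-! ### Existence and uniqueness of the canonical intertwiners -/

section Canonical

variable {F V : Type*} [Field F] [AddCommGroup V] [Module F V]
  {ω : V →ₗ[F] V →ₗ[F] F} {n : ℕ}

theorem average_mul_left (M : OLag ω n) (f : Heisenberg ω → ℂ) {m : V} (hm : m ∈ M.sub)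
    (h : Heisenberg ω) : average M f (ofVec ω m * h) = average M f h := by
  have hmul : ∀ x : M.sub, ofVec ω x.1 * ofVec ω m = ofVec ω (x.1 + m) := fun x => by
    ext
    · rfl
    · simp [ofVec, M.isotropic x.2 hm]
  refine Eq.trans (finsum_congr fun x => ?_) (finsum_comp_equiv (Equiv.addRight (⟨m, hm⟩ : M.sub))
    (f := fun x => f (ofVec ω x.1 * h)))
  rw [← mul_assoc, hmul]
  rfl

/-- Only `p = φ m - m` brings `p + m` into `L`, and its product with `m` in the Heisenberg group has
central part `½ ω(φ m, m)`. -/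
theorem average_delta {ψ : AddChar F ℂ} [FiniteDimensional F V]
    (hn : finrank F V = 2 * n) (hnd : ω.Nondegenerate) (halt : ω.IsAlt)
    {M P L : OLag ω n} (hPL : P.GenPos L) (φ : M.sub →ₗ[F] L.sub)
    (hφ : ∀ m, (φ m : V) - m ∈ P.sub) (m : M.sub) :
    average P (deltaFun ψ L) (ofVec ω m) = ψ (2⁻¹ * ω (φ m) m) := by
  rw [average, finsum_eq_single _ (⟨(φ m : V) - m, hφ m⟩ : P.sub)]
  · rw [deltaFun_of_mem]
    · simp [ofVec, halt.self_eq_zero]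
    · simp [ofVec]
  · intro p hp
    refine deltaFun_of_notMem fun h => hp (Subtype.ext ?_)
    have h1 : (p : V) - (φ m - m) = p + m - φ m := by abel
    exact sub_eq_zero.mp (hPL.eq_zero hn hnd (P.sub.sub_mem p.2 (hφ m))
      (h1 ▸ L.sub.sub_mem h (φ m).2))

theorem IsCanonicalSystem.eq [FiniteDimensional F V] [Fintype F] {ψ : AddChar F ℂ}
    (hq : Odd (Fintype.card F)) (hn : finrank F V = 2 * n) (hnd : ω.Nondegenerate) (halt : ω.IsAlt)
    {T T' : IntertwinerSystem ω n ψ} (hT : IsCanonicalSystem T)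
    (hT' : IsCanonicalSystem T') : T = T' := by
  have hgen : ∀ M L : OLag ω n, M.GenPos L → ∀ f, T M L f = T' M L f := fun M L h f =>
    Subtype.ext (funext fun x => (hT.2 M L h f x).trans (hT'.2 M L h f x).symm)
  funext M L
  -- Both systems factor through `P`, along pairs on which they are prescribed.
  obtain ⟨P, hPM, hPL, -⟩ := exists_genPos_three (two_ne_zero_of_odd hq) hn hnd halt M L L
  refine DFunLike.ext _ _ fun f => ?_
  rw [← hT.1.2 M P L, ← hT'.1.2 M P L, hgen P L hPL, hgen M P hPM.symm]

variable [Finite V] [Fintype F]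

/-- The normalized average `A_{M, L} F_{M, L}` as an intertwining morphism. -/
def normalizedAverage (ψ : AddChar F ℂ) (M L : OLag ω n) :
    Representation.IntertwiningMap (heisRep ψ L) (heisRep ψ M) where
  toFun f := ⟨fun h => normConst ψ M L * average M f.1 h, fun z h => by
      have h1 : ∀ m : M.sub, f.1 (ofVec ω m.1 * (ofCen ω z * h)) = ψ z * f.1 (ofVec ω m.1 * h) :=
        fun m => by rw [← mul_assoc, ← ofCen_mul_comm, mul_assoc, f.2.1]
      beta_reduce
      rw [average, finsum_congr h1, ← mul_finsum, average]
      ring,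
    fun m hm h => by
      beta_reduce
      rw [average_mul_left M f.1 hm]⟩
  map_add' f g := by
    refine Subtype.ext (funext fun h => ?_)
    change normConst ψ M L * average M (fun x => f.1 x + g.1 x) h =
      normConst ψ M L * average M f.1 h + normConst ψ M L * average M g.1 h
    rw [← mul_add, average, finsum_add_distrib (Set.toFinite _) (Set.toFinite _)]
    rfl
  map_smul' c f := by
    refine Subtype.ext (funext fun h => ?_)
    change normConst ψ M L * average M (fun x => c * f.1 x) h =
      c * (normConst ψ M L * average M f.1 h)
    rw [average, ← mul_finsum, average]
    ring
  isIntertwining' g := by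
    refine LinearMap.ext fun f => Subtype.ext (funext fun h => ?_)
    change normConst ψ M L * average M (fun x => f.1 (x * g)) h =
      normConst ψ M L * average M f.1 (h * g)
    simp only [average, mul_assoc]

variable {ψ : AddChar F ℂ}

theorem normalizedAverage_apply (M L : OLag ω n) (f : model ψ L) (h : Heisenberg ω) :
    (normalizedAverage ψ M L f).1 h = normConst ψ M L * average M f.1 h := rfl

variable [FiniteDimensional F V]

theorem normalizedAverage_comp_delta (hn : finrank F V = 2 * n) (hnd : ω.Nondegenerate)
    (halt : ω.IsAlt) {M P L : OLag ω n} [Fintype M.sub] (hPL : P.GenPos L)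
    (φ : M.sub →ₗ[F] L.sub) (hφ : ∀ m, (φ m : V) - m ∈ P.sub) :
    (((normalizedAverage ψ M P).comp (normalizedAverage ψ P L)) (delta ψ L)).1 1 =
      compositeConst ψ P φ := by
  rw [Representation.IntertwiningMap.comp_apply, normalizedAverage_apply, average,
    finsum_eq_sum_of_fintype, compositeConst, mul_assoc, Finset.mul_sum _ _ (normConst ψ P L)]
  congr 1
  refine Finset.sum_congr rfl fun m _ => ?_
  rw [normalizedAverage_apply, mul_one]
  congr 1
  exact average_delta hn hnd halt hPL φ hφ m

theorem normalizedAverage_comp_eq (hq : Odd (Fintype.card F)) (hψ : ψ ≠ 1)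
    (hn : finrank F V = 2 * n) (hnd : ω.Nondegenerate) (halt : ω.IsAlt)
    {M L P P' : OLag ω n} (hPM : P.GenPos M) (hPL : P.GenPos L)
    (hPM' : P'.GenPos M) (hPL' : P'.GenPos L) :
    (normalizedAverage ψ M P).comp (normalizedAverage ψ P L) =
      (normalizedAverage ψ M P').comp (normalizedAverage ψ P' L) := by
  have : Fintype M.sub := Fintype.ofFinite _
  obtain ⟨φ, hφ⟩ := exists_projection (M := M) hn hnd hPL
  obtain ⟨φ', hφ'⟩ := exists_projection (M := M) hn hnd hPL'
  refine intertwiner_ext (two_ne_zero_of_odd hq) hnd halt hψ ?_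
  rw [normalizedAverage_comp_delta hn hnd halt hPL φ hφ,
    normalizedAverage_comp_delta hn hnd halt hPL' φ' hφ']
  exact compositeConst_eq hq hψ hn hnd halt hPM' hPL' hPM hPL φ' hφ' φ hφ

theorem normalizedAverage_comp_genPos (hq : Odd (Fintype.card F)) (hψ : ψ ≠ 1)
    (hn : finrank F V = 2 * n) (hnd : ω.Nondegenerate) (halt : ω.IsAlt)
    {M L P : OLag ω n} (hPM : P.GenPos M) (hPL : P.GenPos L)
    (hML : M.GenPos L) :
    (normalizedAverage ψ M P).comp (normalizedAverage ψ P L) = normalizedAverage ψ M L := by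
  have : Fintype M.sub := Fintype.ofFinite _
  obtain ⟨φ, hφ⟩ := exists_projection (M := M) hn hnd hPL
  refine intertwiner_ext (two_ne_zero_of_odd hq) hnd halt hψ ?_
  rw [normalizedAverage_comp_delta hn hnd halt hPL φ hφ,
    compositeConst_eq_normConst hq hψ hn hnd halt hPM hPL hML φ hφ, normalizedAverage_apply]
  have h1 := average_delta (ψ := ψ) hn hnd halt (P := M) (M := L) hML LinearMap.id (by simp) 0
  have h2 : ofVec ω ((0 : L.sub) : V) = 1 := rfl
  have h3 : (delta ψ L).1 = deltaFun ψ L := rfl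
  rw [h2] at h1
  simp [h3, h1]

theorem normalizedAverage_comp_self (hq : Odd (Fintype.card F)) (hψ : ψ ≠ 1)
    (hn : finrank F V = 2 * n) (hnd : ω.Nondegenerate) (halt : ω.IsAlt)
    {M P : OLag ω n} (hPM : P.GenPos M) :
    (normalizedAverage ψ M P).comp (normalizedAverage ψ P M) =
      Representation.IntertwiningMap.id _ := by
  have : Fintype M.sub := Fintype.ofFinite _
  refine intertwiner_ext (two_ne_zero_of_odd hq) hnd halt hψ ?_
  rw [normalizedAverage_comp_delta hn hnd halt hPM LinearMap.id (by simp),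
    compositeConst_self hq hψ hn hnd halt hPM]
  exact ((deltaFun_of_mem M.sub.zero_mem).trans (AddChar.map_zero_eq_one ψ)).symm

theorem exists_isCanonicalSystem (hq : Odd (Fintype.card F)) (hψ : ψ ≠ 1)
    (hn : finrank F V = 2 * n) (hnd : ω.Nondegenerate) (halt : ω.IsAlt) :
    ∃ T : IntertwinerSystem ω n ψ, IsCanonicalSystem T := by
  have h2 := two_ne_zero_of_odd hq
  choose P hPM hPL _ using fun M L : OLag ω n => exists_genPos_three h2 hn hnd halt M L L
  let T : IntertwinerSystem ω n ψ := fun M L =>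
    (normalizedAverage ψ M (P M L)).comp (normalizedAverage ψ (P M L) L)
  have hT : ∀ M L Q : OLag ω n, Q.GenPos M → Q.GenPos L → ∀ f,
      T M L f = normalizedAverage ψ M Q (normalizedAverage ψ Q L f) := fun M L Q hM hL f =>
    DFunLike.congr_fun
      (normalizedAverage_comp_eq hq hψ hn hnd halt (hPM M L) (hPL M L) hM hL) f
  have hself : ∀ M Q : OLag ω n, Q.GenPos M → ∀ f,
      normalizedAverage ψ M Q (normalizedAverage ψ Q M f) = f := fun M Q h f =>
    DFunLike.congr_fun (normalizedAverage_comp_self hq hψ hn hnd halt h) f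
  have hcocycle : ∀ N M L, ∀ f : model ψ L, T N M (T M L f) = T N L f := by
    intro N M L f
    -- With one `Q` transversal to all three, the inner factors `A_{Q,M} ∘ A_{M,Q}` cancel.
    obtain ⟨Q, hN, hM, hL⟩ := exists_genPos_three h2 hn hnd halt N M L
    rw [hT M L Q hM hL, hT N M Q hN hM, hT N L Q hN hL, hself Q M hM.symm]
  have hid : ∀ M, ∀ f : model ψ M, T M M f = f := fun M f => hself M _ (hPM M M) f
  refine ⟨T, ⟨fun M L => Function.bijective_iff_has_inverse.mpr ⟨T L M, fun f => ?_, fun f => ?_⟩,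
    hcocycle⟩, fun M L hML f h => ?_⟩
  · rw [hcocycle, hid]
  · rw [hcocycle, hid]
  · rw [← normalizedAverage_apply,
      ← normalizedAverage_comp_genPos hq hψ hn hnd halt (hPM M L) (hPL M L) hML]

end Canonical

/-! ### Canonical kernels and their convolution -/

section Kernels

variable {F V : Type*} [Field F] [AddCommGroup V] [Module F V]
  {ω : V →ₗ[F] V →ₗ[F] F} {n : ℕ} [Finite F] [Finite V] {ψ : AddChar F ℂ}

theorem IsKernelFunction.eq_delta (halt : ω.IsAlt) {T : IntertwinerSystem ω n ψ}
    {K : (OLag ω n × OLag ω n) × Heisenberg ω → ℂ} (hK : IsKernelFunction T K) (M L : OLag ω n) :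
    (fun h => K ((M, L), h)) = (T M L (delta ψ L)).1 := by
  rw [(hK M L).2, conv_delta halt (hK M L).1]

theorem isKernelFunction_delta (halt : ω.IsAlt) (T : IntertwinerSystem ω n ψ) :
    IsKernelFunction T fun x => (T x.1.1 x.1.2 (delta ψ x.1.2)).1 x.2 := fun M L =>
  ⟨intertwiner_delta_mem (T M L), fun f => intertwiner_apply_eq_conv halt (T M L) f⟩

theorem existsUnique_isKernelFunction (halt : ω.IsAlt) (T : IntertwinerSystem ω n ψ) :
    ∃! K : (OLag ω n × OLag ω n) × Heisenberg ω → ℂ, IsKernelFunction T K :=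
  ⟨_, isKernelFunction_delta halt T, fun _ hK =>
    funext fun x => congrFun (hK.eq_delta halt x.1.1 x.1.2) x.2⟩

theorem IsKernelFunction.fiberConv_eq (halt : ω.IsAlt) {T : IntertwinerSystem ω n ψ}
    (hT : IsTrivialization T) {K : (OLag ω n × OLag ω n) × Heisenberg ω → ℂ}
    (hK : IsKernelFunction T K) : fiberConv (K ∘ p₁₂) (K ∘ p₂₃) = K ∘ p₁₃ := by
  funext ⟨⟨L₁, L₂, L₃⟩, h⟩
  change conv L₂.zSubgroup (fun h => K ((L₁, L₂), h)) (fun h => K ((L₂, L₃), h)) h =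
    (fun h => K ((L₁, L₃), h)) h
  -- Only the second kernel is written as `T δ`; the first then acts on it by convolution, that is,
  -- as `T L₁ L₂`.
  rw [hK.eq_delta halt L₂ L₃, ← (hK L₁ L₂).2, hT.2, hK.eq_delta halt L₁ L₃]

end Kernels

end StrongSvN

end

theorem mainTheorem5 {F V : Type*} [Field F] [Fintype F] (hq : Odd (Fintype.card F))
    [AddCommGroup V] [Module F V] [FiniteDimensional F V]
    (n : ℕ) (hn : Module.finrank F V = 2 * n)
    (ω : V →ₗ[F] V →ₗ[F] F) (halt : ω.IsAlt) (hnd : ω.Nondegenerate)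
    (ψ : AddChar F ℂ) (hψ : ψ ≠ 1) :
    (∃! T : StrongSvN.IntertwinerSystem ω n ψ, StrongSvN.IsCanonicalSystem T) ∧
      ∀ T : StrongSvN.IntertwinerSystem ω n ψ, StrongSvN.IsCanonicalSystem T →
        (∃! K : (StrongSvN.OLag ω n × StrongSvN.OLag ω n) × StrongSvN.Heisenberg ω → ℂ,
          StrongSvN.IsKernelFunction T K) ∧
        ∀ K : (StrongSvN.OLag ω n × StrongSvN.OLag ω n) × StrongSvN.Heisenberg ω → ℂ,
          StrongSvN.IsKernelFunction T K →
            StrongSvN.fiberConv (K ∘ StrongSvN.p₁₂) (K ∘ StrongSvN.p₂₃) = K ∘ StrongSvN.p₁₃ := by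
  have : Finite V := Module.finite_of_finite F
  refine ⟨?_, fun T hT => ⟨StrongSvN.existsUnique_isKernelFunction halt T, fun K hK =>
    hK.fiberConv_eq halt hT.1⟩⟩
  obtain ⟨T, hT⟩ := StrongSvN.exists_isCanonicalSystem hq hψ hn hnd halt
  exact ⟨T, hT, fun T' hT' => hT'.eq hq hn hnd halt hT⟩
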